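/- \textbf{Setup.} For $n\ge 1$ let $\gamma_n$ be a generator of the cyclic group $C_{2^n}$ and let $\mathcal R_n=\pi_*^e BP^{(\!(C_{2^n})\!)}$ be the underlying homotopy ring of the norm $BP^{(\!(C_{2^n})\!)}=N_{C_2}^{C_{2^n}}BP_{\mathbb R}$, with its $C_{2^n}$-action. It is described algebraically as follows. Write $\pi_*BP\otimes\mathbb Q=\mathbb Q[\ell_1,\ell_2,\dots]$, $\ell_0=1$, where $\log_{\mathcal F}(x)=\sum_{k\ge 0}\ell_k x^{2^k}$ is the logarithm of the universal $2$-typical formal group law $\mathcal F$. Then $\mathcal R_n\otimes\mathbb Q=\mathbb Q[\gamma_n^i\ell_k : 0\le i<2^{n-1},\,k\ge 1]$ with $\gamma_n^{2^{n-1}}\ell_k=-\ell_k$ for $k\ge 1$, and $\mathcal R_n$ is the $\mathbb Z_{(2)}$-subalgebra generated by the coefficients of the formal group laws $\mathcal F^{g}$ and of the canonical strict isomorphisms $\mathcal F^{g}\to\mathcal F^{g'}$, $g,g'\in C_{2^n}$. Here $\mathcal F^{g}$ is obtained by applying $g$ to the coefficients of $\mathcal F$, and the canonical strict isomorphism is $\log_{\mathcal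 F^{g'}}^{-1}\circ\log_{\mathcal F^{g}}$. For $1\le r\le n$ the left units give the $C_{2^r}$-equivariant inclusion $\mathcal R_r\hookrightarrow\mathcal R_n$ with $\ell_k\mapsto\ell_k$, where $C_{2^r}\subseteq C_{2^n}$ has generator $\gamma_r=\gamma_n^{2^{n-r}}$; elements of $\mathcal R_r$ are regarded as elements of $\mathcal R_n$. Let $\psi_{\gamma_n}\colon\mathcal F\to\mathcal F^{\gamma_n}$ be the canonical strict isomorphism over $\mathcal R_n$. The elements $t_k^{C_{2^n}}\in\mathcal R_n$ and the Araki generators $v_k\in\mathcal R_n$ are the coefficients in $$\psi_{\gamma_n}(x)=\sum_{k\ge 0}{}^{\mathcal F^{\gamma_n}}\,t_k^{C_{2^n}}x^{2^k},\quad t_0^{C_{2^n}}=1,\qquad [2]_{\mathcal F}(x)=\sum_{k\ge 0}{}^{\mathcal F}\,v_kx^{2^k},$$ and $I_k=(2,v_1,\dots,v_{k-1})\subseteq\mathcal R_n$. \textbf{Theorem.} For every $n\ge 1$ these expansions of $\psi_{\gamma_n}$ and $[2]_{\mathcal F}$ exist over $\mathcal R_n$. For all $n\ge 2$ and $k\ge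 1$, $$t_k^{C_{2^{n-1}}}\equiv t_k^{C_{2^n}}+\gamma_n t_k^{C_{2^n}}+\sum_{j=1}^{k-1}\gamma_n t_j^{C_{2^n}}\,\bigl(t_{k-j}^{C_{2^n}}\bigr)^{2^j}\pmod{I_k}$$ in $\mathcal R_n$. Moreover, for all $n\ge 1$ and $k\ge 1$, $t_k^{C_2}\equiv v_k\pmod{I_k}$ in $\mathcal R_n$. -/

import Mathlib

/-! ## Formal group laws: logarithms, strict isomorphisms, formal sums -/

namespace FormalGroup

variable {A : Type*} [CommRing A]

theorem subst_logSum {σ : Type*} (l e : PowerSeries A) (hl0 : l.constantCoeff = 0)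
    {p q : MvPowerSeries σ A} (hp : p.constantCoeff = 0) (hq : q.constantCoeff = 0) :
    MvPowerSeries.subst ![p, q] (e.subst
      (l.subst (MvPowerSeries.X 0 : MvPowerSeries (Fin 2) A) + l.subst (MvPowerSeries.X 1))) =
    e.subst (l.subst p + l.subst q) := by
  have hpq : MvPowerSeries.HasSubst ![p, q] :=
    MvPowerSeries.hasSubst_of_constantCoeff_zero fun s => by fin_cases s <;> simpa
  have hX (i : Fin 2) : PowerSeries.HasSubst (MvPowerSeries.X i : MvPowerSeries (Fin 2) A) :=
    PowerSeries.HasSubst.X i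
  have h0 : ∀ i : Fin 2, (l.subst (MvPowerSeries.X i : MvPowerSeries (Fin 2) A)).constantCoeff = 0 :=
    fun i => PowerSeries.constantCoeff_subst_eq_zero (by simp) _ hl0
  have hs : PowerSeries.HasSubst
      (l.subst (MvPowerSeries.X 0 : MvPowerSeries (Fin 2) A) + l.subst (MvPowerSeries.X 1)) :=
    PowerSeries.HasSubst.of_constantCoeff_zero (by simp [h0])
  have key : ∀ i : Fin 2, MvPowerSeries.subst ![p, q]
      (l.subst (MvPowerSeries.X i : MvPowerSeries (Fin 2) A)) = l.subst (![p, q] i) := by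
    intro i
    rw [PowerSeries.subst_def, MvPowerSeries.subst_comp_subst_apply (hX i).const hpq,
      PowerSeries.subst_def]
    congr 1
    funext _
    rw [MvPowerSeries.subst_X hpq]
  rw [PowerSeries.subst_def _ e, MvPowerSeries.subst_comp_subst_apply hs.const hpq,
    PowerSeries.subst_def]
  congr 1
  funext _
  rw [MvPowerSeries.subst_add hpq]
  exact congrArg₂ (· + ·) (key 0) (key 1)

theorem subst_subst_cancel {σ : Type*} {l e : PowerSeries A} (he0 : e.constantCoeff = 0)
    (hle : l.subst e = PowerSeries.X)
    {z : MvPowerSeries σ A} (hz : z.constantCoeff = 0) : l.subst (e.subst z) = z := by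
  have hz' := PowerSeries.HasSubst.of_constantCoeff_zero hz
  rw [← PowerSeries.subst_comp_subst_apply (PowerSeries.HasSubst.of_constantCoeff_zero' he0) hz',
    hle, PowerSeries.subst_X hz']

theorem coeff_single_one_subst {σ : Type*} [DecidableEq σ] (f : PowerSeries A)
    (hf1 : f.coeff 1 = 1) {z : MvPowerSeries σ A} (hz : z.constantCoeff = 0) (s : σ) :
    (f.subst z).coeff (Finsupp.single s 1) = z.coeff (Finsupp.single s 1) := by
  rw [PowerSeries.coeff_subst (PowerSeries.HasSubst.of_constantCoeff_zero hz),
    finsum_eq_single _ 1]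
  · simp [hf1]
  · intro d hd
    rcases d with _ | _ | d
    · simp [MvPowerSeries.coeff_one]
    · simp at hd
    · have : (z ^ (d + 1 + 1)).coeff (Finsupp.single s 1) = 0 := by
        apply MvPowerSeries.coeff_of_lt_order
        refine lt_of_lt_of_le ?_
          (MvPowerSeries.le_order_pow_of_constantCoeff_eq_zero (d + 1 + 1) hz)
        simp only [Finsupp.degree_single]
        exact_mod_cast (by omega : 1 < d + 1 + 1)
      rw [this, smul_zero]

/-- The formal group law `e (l (x) + l (y))`, where `l (x) = x + ⋯` has compositional inverse `e`.
Its logarithm is `l`. -/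
noncomputable def ofLog (l e : PowerSeries A) (hl0 : l.constantCoeff = 0)
    (hl1 : l.coeff 1 = 1) (he0 : e.constantCoeff = 0) (he1 : e.coeff 1 = 1)
    (hle : l.subst e = PowerSeries.X) : FormalGroup A where
  toPowerSeries := e.subst
    (l.subst (MvPowerSeries.X 0 : MvPowerSeries (Fin 2) A) + l.subst (MvPowerSeries.X 1))
  zero_constantCoeff := by
    have h0 : ∀ i : Fin 2,
        (l.subst (MvPowerSeries.X i : MvPowerSeries (Fin 2) A)).constantCoeff = 0 :=
      fun i => PowerSeries.constantCoeff_subst_eq_zero (by simp) _ hl0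
    exact PowerSeries.constantCoeff_subst_eq_zero (by simp [h0]) _ he0
  lin_coeff_X := by
    have h0 : ∀ i : Fin 2,
        (l.subst (MvPowerSeries.X i : MvPowerSeries (Fin 2) A)).constantCoeff = 0 :=
      fun i => PowerSeries.constantCoeff_subst_eq_zero (by simp) _ hl0
    rw [coeff_single_one_subst e he1 (by simp [h0]), map_add,
      coeff_single_one_subst l hl1 (by simp), coeff_single_one_subst l hl1 (by simp)]
    simp [MvPowerSeries.coeff_index_single_X]
  lin_coeff_Y := by
    have h0 : ∀ i : Fin 2,
        (l.subst (MvPowerSeries.X i : MvPowerSeries (Fin 2) A)).constantCoeff = 0 :=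
      fun i => PowerSeries.constantCoeff_subst_eq_zero (by simp) _ hl0
    rw [coeff_single_one_subst e he1 (by simp [h0]), map_add,
      coeff_single_one_subst l hl1 (by simp), coeff_single_one_subst l hl1 (by simp)]
    simp [MvPowerSeries.coeff_index_single_X]
  assoc := by
    have h0 {z : MvPowerSeries (Fin 3) A} (hz : z.constantCoeff = 0) :
        (l.subst z).constantCoeff = 0 := PowerSeries.constantCoeff_subst_eq_zero hz _ hl0
    have hX (i : Fin 3) : (MvPowerSeries.X i : MvPowerSeries (Fin 3) A).constantCoeff = 0 := by
      simp
    have hadd {z w : MvPowerSeries (Fin 3) A} (hz : z.constantCoeff = 0)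
        (hw : w.constantCoeff = 0) : (l.subst z + l.subst w).constantCoeff = 0 := by
      rw [map_add, h0 hz, h0 hw, _root_.add_zero]
    have hF {z w : MvPowerSeries (Fin 3) A} (hz : z.constantCoeff = 0)
        (hw : w.constantCoeff = 0) : (e.subst (l.subst z + l.subst w)).constantCoeff = 0 :=
      PowerSeries.constantCoeff_subst_eq_zero (hadd hz hw) _ he0
    rw [subst_logSum l e hl0 (hX 0) (hX 1), subst_logSum l e hl0 (hX 1) (hX 2),
      subst_logSum l e hl0 (hF (hX 0) (hX 1)) (hX 2),
      subst_logSum l e hl0 (hX 0) (hF (hX 1) (hX 2)),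
      subst_subst_cancel he0 hle (hadd (hX 0) (hX 1)),
      subst_subst_cancel he0 hle (hadd (hX 1) (hX 2)), add_assoc]

/-- A strict isomorphism `F → G` of formal group laws over `A`: a power series
`ψ (x) = x + ⋯` with `ψ (F (x, y)) = G (ψ (x), ψ (y))`. -/
structure StrictIso (F G : FormalGroup A) where
  toPowerSeries : PowerSeries A
  constantCoeff_eq : toPowerSeries.constantCoeff = 0
  coeff_one_eq : toPowerSeries.coeff 1 = 1
  hom : toPowerSeries.subst F.toPowerSeries =
    G.toPowerSeries.subst ![toPowerSeries.subst (MvPowerSeries.X 0 : MvPowerSeries (Fin 2) A),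
      toPowerSeries.subst (MvPowerSeries.X 1 : MvPowerSeries (Fin 2) A)]

/-- If `F` and `G` have logarithms `l` and `l'`, and `e'` is the inverse of `l'`, then
`e' (l (x))` is a strict isomorphism `F → G`. -/
noncomputable def StrictIso.ofLog {F G : FormalGroup A} (l e l' e' : PowerSeries A)
    (hl0 : l.constantCoeff = 0) (hl1 : l.coeff 1 = 1) (he0 : e.constantCoeff = 0)
    (hle : l.subst e = PowerSeries.X) (hl0' : l'.constantCoeff = 0)
    (he0' : e'.constantCoeff = 0) (he1' : e'.coeff 1 = 1) (hle' : l'.subst e' = PowerSeries.X)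
    (hF : F.toPowerSeries = e.subst
      (l.subst (MvPowerSeries.X 0 : MvPowerSeries (Fin 2) A) + l.subst (MvPowerSeries.X 1)))
    (hG : G.toPowerSeries = e'.subst
      (l'.subst (MvPowerSeries.X 0 : MvPowerSeries (Fin 2) A) + l'.subst (MvPowerSeries.X 1))) :
    StrictIso F G where
  toPowerSeries := e'.subst l
  constantCoeff_eq := PowerSeries.constantCoeff_subst_eq_zero hl0 _ he0'
  coeff_one_eq := by
    have := coeff_single_one_subst e' he1' (z := l) hl0 ()
    exact this.trans hl1
  hom := by
    have hX (i : Fin 2) : (MvPowerSeries.X i : MvPowerSeries (Fin 2) A).constantCoeff = 0 := by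
      simp
    have h0 {z : MvPowerSeries (Fin 2) A} (hz : z.constantCoeff = 0) :
        (l.subst z).constantCoeff = 0 := PowerSeries.constantCoeff_subst_eq_zero hz _ hl0
    have hz : (l.subst (MvPowerSeries.X 0 : MvPowerSeries (Fin 2) A) +
        l.subst (MvPowerSeries.X 1)).constantCoeff = 0 := by
      rw [map_add, h0 (hX 0), h0 (hX 1), _root_.add_zero]
    have hc {z : MvPowerSeries (Fin 2) A} (hz : z.constantCoeff = 0) :
        PowerSeries.subst z (e'.subst l) = e'.subst (l.subst z) :=
      PowerSeries.subst_comp_subst_apply (PowerSeries.HasSubst.of_constantCoeff_zero' hl0)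
        (PowerSeries.HasSubst.of_constantCoeff_zero hz) _
    have he {z : MvPowerSeries (Fin 2) A} (hz : z.constantCoeff = 0) :
        (e'.subst (l.subst z)).constantCoeff = 0 :=
      PowerSeries.constantCoeff_subst_eq_zero (h0 hz) _ he0'
    rw [hF, hG, hc (PowerSeries.constantCoeff_subst_eq_zero hz _ he0),
      subst_subst_cancel he0 hle hz, hc (hX 0), hc (hX 1),
      subst_logSum l' e' hl0' (he (hX 0)) (he (hX 1)),
      subst_subst_cancel he0' hle' (h0 (hX 0)), subst_subst_cancel he0' hle' (h0 (hX 1))]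

/-- Restriction of a formal group law to a subring that contains its coefficients. -/
noncomputable def toSubring (F : FormalGroup A) (S : Subring A)
    (h : ∀ d, F.toPowerSeries.coeff d ∈ S) : FormalGroup S where
  toPowerSeries := fun d => ⟨F.toPowerSeries.coeff d, h d⟩
  zero_constantCoeff := Subtype.ext F.zero_constantCoeff
  lin_coeff_X := Subtype.ext F.lin_coeff_X
  lin_coeff_Y := Subtype.ext F.lin_coeff_Y
  assoc := by
    set f : MvPowerSeries (Fin 2) S := fun d => ⟨F.toPowerSeries.coeff d, h d⟩ with hf
    have hmap : f.map S.subtype = F.toPowerSeries := rfl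
    have hf0 : f.constantCoeff = 0 := Subtype.ext F.zero_constantCoeff
    have hinj : Function.Injective (MvPowerSeries.map (σ := Fin 3) S.subtype) := by
      intro p q hpq
      ext d
      exact congrArg (MvPowerSeries.coeff d) hpq
    apply hinj
    have hv (g₁ g₂ : MvPowerSeries (Fin 3) S) :
        (fun i => (![g₁, g₂] i).map S.subtype) = ![g₁.map S.subtype, g₂.map S.subtype] := by
      ext1 i; fin_cases i <;> simp
    rw [MvPowerSeries.map_subst (MvPowerSeries.HasSubst.cons_subst_zero_left (0 : Fin 3) 1 2 hf0),
      MvPowerSeries.map_subst (MvPowerSeries.HasSubst.cons_subst_zero_right (0 : Fin 3) 1 2 hf0),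
      hv, hv, MvPowerSeries.map_subst .X_X, MvPowerSeries.map_subst .X_X, hv, hv, hmap]
    simpa using F.assoc

/-- Restriction of a strict isomorphism to a subring that contains all coefficients. -/
noncomputable def StrictIso.toSubring {S : Subring A} {F G : FormalGroup S}
    {F' G' : FormalGroup A} (hF : F.map S.subtype = F') (hG : G.map S.subtype = G')
    (ψ : StrictIso F' G') (h : ∀ d, ψ.toPowerSeries.coeff d ∈ S) : StrictIso F G where
  toPowerSeries := ψ.toPowerSeries.toSubring S h
  constantCoeff_eq := Subtype.ext <| by simpa using ψ.constantCoeff_eq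
  coeff_one_eq := Subtype.ext <| by simpa using ψ.coeff_one_eq
  hom := by
    subst hF hG
    set f := ψ.toPowerSeries.toSubring S h with hf
    have hmap : PowerSeries.map S.subtype f = ψ.toPowerSeries := PowerSeries.map_toSubring _ _ _
    have hf0 : f.constantCoeff = 0 := Subtype.ext <| by simpa [hf] using ψ.constantCoeff_eq
    have hinj : Function.Injective (MvPowerSeries.map (σ := Fin 2) S.subtype) := by
      intro p q hpq
      ext d
      exact congrArg (MvPowerSeries.coeff d) hpq
    apply hinj
    have hX (i : Fin 2) : PowerSeries.HasSubst (MvPowerSeries.X i : MvPowerSeries (Fin 2) S) :=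
      PowerSeries.HasSubst.X i
    have hv (g₁ g₂ : MvPowerSeries (Fin 2) S) :
        (fun i => (![g₁, g₂] i).map S.subtype) = ![g₁.map S.subtype, g₂.map S.subtype] := by
      ext1 i; fin_cases i <;> simp
    have h0 (i : Fin 2) :
        (f.subst (MvPowerSeries.X i : MvPowerSeries (Fin 2) S)).constantCoeff = 0 :=
      PowerSeries.constantCoeff_subst_eq_zero (by simp) _ hf0
    have hs : MvPowerSeries.HasSubst
        ![f.subst (MvPowerSeries.X 0 : MvPowerSeries (Fin 2) S),
          f.subst (MvPowerSeries.X 1 : MvPowerSeries (Fin 2) S)] :=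
      MvPowerSeries.hasSubst_of_constantCoeff_zero fun s => by fin_cases s <;> simp [h0]
    rw [PowerSeries.map_subst
      (PowerSeries.HasSubst.of_constantCoeff_zero F.zero_constantCoeff), hmap,
      MvPowerSeries.map_subst hs, hv, PowerSeries.map_subst (hX 0), PowerSeries.map_subst (hX 1),
      hmap]
    simpa using ψ.hom

/-- The partial sums `a 0 +_F a 1 +_F ⋯ +_F a (m - 1)` of a formal sum. -/
noncomputable def partialSum (F : FormalGroup A) (a : ℕ → PowerSeries A) : ℕ → PowerSeries A
  | 0 => 0
  | m + 1 => F.toPowerSeries.subst ![partialSum F a m, a m]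

/-- `c = ∑^F_{i ≥ 0} a i`: the partial sums of the formal sum converge to `c`, that is,
each of their coefficients is eventually the one of `c`. -/
def HasFormalSum (F : FormalGroup A) (a : ℕ → PowerSeries A) (c : PowerSeries A) : Prop :=
  ∀ d, ∀ᶠ m in Filter.atTop, (partialSum F a m).coeff d = c.coeff d

/-- The partial sums of the expansion `c = ∑^F_{i ≥ 0} c_i x ^ (2 ^ i)`; the coefficient `c_m` is
chosen so that the sum up to `m` agrees with `c` at `x ^ (2 ^ m)`. -/
noncomputable def expansionPartial (F : FormalGroup A) (c : PowerSeries A) : ℕ → PowerSeries A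
  | 0 => 0
  | m + 1 => F.toPowerSeries.subst ![expansionPartial F c m,
      PowerSeries.C (c.coeff (2 ^ m) - (expansionPartial F c m).coeff (2 ^ m)) *
        PowerSeries.X ^ 2 ^ m]

/-- The coefficients `c_i` of the expansion `c = ∑^F_{i ≥ 0} c_i x ^ (2 ^ i)`, whenever `c` has
one: the sum up to `i` is congruent to (sum up to `i - 1`) `+ c_i x ^ (2 ^ i)` modulo higher powers
of `x`, and the later summands do not contribute to the coefficient of `x ^ (2 ^ i)`. -/
noncomputable def expansionCoeff (F : FormalGroup A) (c : PowerSeries A) (i : ℕ) : A :=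
  c.coeff (2 ^ i) - (expansionPartial F c i).coeff (2 ^ i)

/-- The 2-series `[2]_F (x) = F (x, x)`. -/
noncomputable def twoSeries (F : FormalGroup A) : PowerSeries A :=
  F.toPowerSeries.subst ![(PowerSeries.X : PowerSeries A), PowerSeries.X]

end FormalGroup

/-! ## The universal 2-typical formal group law -/

namespace BPNorm

open FormalGroup

/-- `π_* BP ⊗ ℚ = ℚ[ℓ₁, ℓ₂, …]`; the variable `k` is `ℓ_{k+1}`. -/
abbrev BPQ : Type := MvPolynomial ℕ ℚ

/-- The logarithm coefficients, with `ℓ₀ = 1`. -/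
noncomputable def ell : ℕ → BPQ
  | 0 => 1
  | k + 1 => MvPolynomial.X k

/-- The logarithm `∑_{k ≥ 0} ℓ_k x ^ (2 ^ k)` of the universal 2-typical formal group law. -/
noncomputable def logBP : PowerSeries BPQ :=
  PowerSeries.mk fun d => if d = 2 ^ Nat.log 2 d then ell (Nat.log 2 d) else 0

theorem logBP_zero : logBP.constantCoeff = 0 := by
  rw [← PowerSeries.coeff_zero_eq_constantCoeff_apply]
  simp [logBP]

theorem logBP_one : logBP.coeff 1 = 1 := by
  simp [logBP, ell]

/-- The compositional inverse of `logBP`. -/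
noncomputable def expBP : PowerSeries BPQ :=
  logBP.substInvOfIsUnit (by rw [logBP_one]; exact isUnit_one)

theorem expBP_zero : expBP.constantCoeff = 0 := by simp [expBP]

theorem logBP_expBP : logBP.subst expBP = PowerSeries.X :=
  PowerSeries.subst_substInvOfIsUnit_right _ logBP_zero _

theorem expBP_one : expBP.coeff 1 = 1 := by
  have h := coeff_single_one_subst logBP logBP_one (z := expBP) expBP_zero ()
  refine Eq.trans (Eq.symm h) ?_
  change PowerSeries.coeff 1 (logBP.subst expBP) = 1
  rw [logBP_expBP, PowerSeries.coeff_one_X]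

/-- The universal 2-typical formal group law, with its coefficients in `π_* BP ⊗ ℚ`. -/
noncomputable def fglBP : FormalGroup BPQ :=
  ofLog logBP expBP logBP_zero logBP_one expBP_zero expBP_one logBP_expBP

/-! ## The ring `π_*^e BP^((C_{2^n}))` -/

/-- `π_*^e BP^((C_{2^n})) ⊗ ℚ`, for `n ≥ 1`: a polynomial ring on `2 ^ (n - 1)` copies of the
`ℓ_k`, `k ≥ 1`, one for each smash factor `BP`.  The variable `(i, k)` is `γ_n ^ i ℓ_{k+1}`. -/
abbrev NormQ (n : ℕ) : Type := MvPolynomial (Fin (2 ^ (n - 1)) × ℕ) ℚ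

/-- The variable `ℓ_{k+1}` of the first smash factor. -/
noncomputable def NormQ.base (n k : ℕ) : NormQ n :=
  MvPolynomial.X (⟨0, by positivity⟩, k)

/-- The action of the generator `γ_n` of `C_{2^n}`: it permutes the smash factors cyclically,
and `γ_n ^ (2 ^ (n - 1))`, the generator of `C_2`, acts on each factor `BP` by complex conjugation,
so by the sign `(-1) ^ (2 ^ k - 1) = -1` on `ℓ_k`, `k ≥ 1`. -/
noncomputable def gammaQ (n : ℕ) : NormQ n →ₐ[ℚ] NormQ n :=
  MvPolynomial.aeval fun p =>
    if h : p.1.val + 1 < 2 ^ (n - 1) then MvPolynomial.X (⟨p.1.val + 1, h⟩, p.2)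
    else - NormQ.base n p.2

/-- The map `π_* BP ⊗ ℚ → π_*^e BP^((C_{2^n})) ⊗ ℚ` given by the left unit followed by
`γ_n ^ i`. -/
noncomputable def unitQ (n i : ℕ) : BPQ →ₐ[ℚ] NormQ n :=
  MvPolynomial.aeval fun k => (gammaQ n ^ i) (NormQ.base n k)

/-- The formal group law `ℱ^(γ_n^i)` over `π_*^e BP^((C_{2^n})) ⊗ ℚ`. -/
noncomputable def fglQ (n i : ℕ) : FormalGroup (NormQ n) :=
  fglBP.map (unitQ n i : BPQ →+* NormQ n)

theorem fglQ_eq (n i : ℕ) : (fglQ n i).toPowerSeries =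
    (expBP.map (unitQ n i : BPQ →+* NormQ n)).subst
      ((logBP.map (unitQ n i : BPQ →+* NormQ n)).subst
        (MvPowerSeries.X 0 : MvPowerSeries (Fin 2) (NormQ n)) +
        (logBP.map (unitQ n i : BPQ →+* NormQ n)).subst (MvPowerSeries.X 1)) := by
  have hX (i : Fin 2) : PowerSeries.HasSubst (MvPowerSeries.X i : MvPowerSeries (Fin 2) BPQ) :=
    PowerSeries.HasSubst.X i
  have h0 (i : Fin 2) :
      (logBP.subst (MvPowerSeries.X i : MvPowerSeries (Fin 2) BPQ)).constantCoeff = 0 :=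
    PowerSeries.constantCoeff_subst_eq_zero (by simp) _ logBP_zero
  rw [fglQ, FormalGroup.map_toPowerSeries, fglBP, ofLog,
    PowerSeries.map_subst (PowerSeries.HasSubst.of_constantCoeff_zero (by simp [h0])),
    map_add, PowerSeries.map_subst (hX 0), PowerSeries.map_subst (hX 1)]
  simp

theorem constantCoeff_map_eq_zero {n : ℕ} {p : PowerSeries BPQ} (hp : p.constantCoeff = 0)
    (φ : BPQ →+* NormQ n) : (p.map φ).constantCoeff = 0 := by
  rw [← PowerSeries.coeff_zero_eq_constantCoeff_apply, PowerSeries.coeff_map,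
    PowerSeries.coeff_zero_eq_constantCoeff_apply, hp, map_zero]

theorem coeff_one_map_eq_one {n : ℕ} {p : PowerSeries BPQ} (hp : p.coeff 1 = 1)
    (φ : BPQ →+* NormQ n) : (p.map φ).coeff 1 = 1 := by
  rw [PowerSeries.coeff_map, hp, map_one]

theorem log_exp_map (n i : ℕ) : (logBP.map (unitQ n i : BPQ →+* NormQ n)).subst
    (expBP.map (unitQ n i : BPQ →+* NormQ n)) = PowerSeries.X := by
  have h := congrArg (PowerSeries.map (unitQ n i : BPQ →+* NormQ n)) logBP_expBP
  rw [PowerSeries.map_X] at h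
  rw [← h]
  exact (PowerSeries.map_subst (PowerSeries.HasSubst.of_constantCoeff_zero' expBP_zero) _).symm

/-- The canonical strict isomorphism `ℱ^(γ_n^i) → ℱ^(γ_n^j)`; over a ℚ-algebra it is the unique
one, the logarithm of the source followed by the inverse of the logarithm of the target. -/
noncomputable def psiQ (n i j : ℕ) : StrictIso (fglQ n i) (fglQ n j) :=
  StrictIso.ofLog (logBP.map (unitQ n i : BPQ →+* NormQ n))
    (expBP.map (unitQ n i : BPQ →+* NormQ n)) (logBP.map (unitQ n j : BPQ →+* NormQ n))
    (expBP.map (unitQ n j : BPQ →+* NormQ n))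
    (constantCoeff_map_eq_zero logBP_zero _) (coeff_one_map_eq_one logBP_one _)
    (constantCoeff_map_eq_zero expBP_zero _) (log_exp_map n i)
    (constantCoeff_map_eq_zero logBP_zero _) (constantCoeff_map_eq_zero expBP_zero _)
    (coeff_one_map_eq_one expBP_one _) (log_exp_map n j)
    (fglQ_eq n i) (fglQ_eq n j)

/-- The coefficients of the formal group laws `ℱ^g` and of the canonical strict isomorphisms
`ℱ^g → ℱ^(g')`, for `g, g'` in `C_{2^n}`. -/
def structureCoeffs (n : ℕ) : Set (NormQ n) :=
  {a | ∃ i d, a = (fglQ n i).toPowerSeries.coeff d} ∪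
    {a | ∃ i j d, a = (psiQ n i j).toPowerSeries.coeff d}

/-- `ℛ_n = π_*^e BP^((C_{2^n}))`, as a subring of `π_*^e BP^((C_{2^n})) ⊗ ℚ`: the
`ℤ_(2)`-subalgebra generated by the coefficients of the formal group laws of the smash factors `BP`
and of the canonical strict isomorphisms between them (`ℤ_(2)` is the ring of rational
numbers with odd denominator). -/
noncomputable def R (n : ℕ) : Subring (NormQ n) :=
  Subring.closure ({a | ∃ q : ℚ, Odd q.den ∧ a = MvPolynomial.C q} ∪ structureCoeffs n)

theorem fglQ_coeff_mem (n i : ℕ) (d) : (fglQ n i).toPowerSeries.coeff d ∈ R n :=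
  Subring.subset_closure (.inr (.inl ⟨i, d, rfl⟩))

theorem psiQ_coeff_mem (n i j d : ℕ) : (psiQ n i j).toPowerSeries.coeff d ∈ R n :=
  Subring.subset_closure (.inr (.inr ⟨i, j, d, rfl⟩))

/-- A ring homomorphism that carries the formal group laws and strict isomorphisms at level `r` to
those at level `n` carries `ℛ_r` to `ℛ_n`. -/
theorem map_mem_R {r n : ℕ} (φ : NormQ r →ₐ[ℚ] NormQ n) (s : ℕ → ℕ)
    (h : ∀ i, φ.comp (unitQ r i) = unitQ n (s i)) {a : NormQ r} (ha : a ∈ R r) : φ a ∈ R n := by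
  have hφ (i : ℕ) : (φ : NormQ r →+* NormQ n).comp (unitQ r i : BPQ →+* NormQ r) =
      (unitQ n (s i) : BPQ →+* NormQ n) := by
    rw [← h i]; rfl
  have hmap (i : ℕ) (p : PowerSeries BPQ) : PowerSeries.map (φ : NormQ r →+* NormQ n)
      (p.map (unitQ r i : BPQ →+* NormQ r)) = p.map (unitQ n (s i) : BPQ →+* NormQ n) := by
    rw [← hφ i, PowerSeries.map_comp]; rfl
  suffices R r ≤ (R n).comap (φ : NormQ r →+* NormQ n) from this ha
  refine Subring.closure_le.mpr ?_
  rintro a (⟨q, hq, rfl⟩ | ⟨i, d, rfl⟩ | ⟨i, j, d, rfl⟩)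
  · refine Subring.subset_closure (.inl ⟨q, hq, ?_⟩)
    exact φ.commutes q
  · have : φ ((fglQ r i).toPowerSeries.coeff d) = (fglQ n (s i)).toPowerSeries.coeff d := by
      simp only [fglQ, FormalGroup.map_toPowerSeries, MvPowerSeries.coeff_map, ← hφ i]
      rfl
    exact Subring.mem_comap.mpr (by simpa [this] using fglQ_coeff_mem n (s i) d)
  · have : φ ((psiQ r i j).toPowerSeries.coeff d) =
        (psiQ n (s i) (s j)).toPowerSeries.coeff d := by
      have h1 : (psiQ n (s i) (s j)).toPowerSeries =
          PowerSeries.map (φ : NormQ r →+* NormQ n) (psiQ r i j).toPowerSeries := by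
        change (expBP.map (unitQ n (s j) : BPQ →+* NormQ n)).subst
          (logBP.map (unitQ n (s i) : BPQ →+* NormQ n)) = PowerSeries.map _
            ((expBP.map (unitQ r j : BPQ →+* NormQ r)).subst
              (logBP.map (unitQ r i : BPQ →+* NormQ r)))
        rw [← hmap, ← hmap]
        exact (PowerSeries.map_subst
          (PowerSeries.HasSubst.of_constantCoeff_zero'
            (constantCoeff_map_eq_zero logBP_zero _)) _).symm
      rw [h1, PowerSeries.coeff_map]
      rfl
    exact Subring.mem_comap.mpr (by simpa [this] using psiQ_coeff_mem n (s i) (s j) d)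

theorem gammaQ_comp_unitQ (n i : ℕ) : (gammaQ n).comp (unitQ n i) = unitQ n (i + 1) := by
  refine MvPolynomial.algHom_ext fun k => ?_
  simp [unitQ, pow_succ']

/-- The action of `γ_n` on `ℛ_n`. -/
noncomputable def gamma (n : ℕ) : R n →+* R n :=
  (gammaQ n : NormQ n →+* NormQ n).restrict (R n) (R n)
    fun _ h => map_mem_R (gammaQ n) (· + 1) (gammaQ_comp_unitQ n) h

theorem gammaQ_pow_base (n k i : ℕ) (hi : i < 2 ^ (n - 1)) :
    (gammaQ n ^ i) (NormQ.base n k) = MvPolynomial.X (⟨i, hi⟩, k) := by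
  induction i with
  | zero => rfl
  | succ i ih =>
    rw [pow_succ', AlgHom.mul_apply, ih (by omega), gammaQ, MvPolynomial.aeval_X]
    simp [hi]

theorem gammaQ_pow_half (n k : ℕ) :
    (gammaQ n ^ 2 ^ (n - 1)) (NormQ.base n k) = -NormQ.base n k := by
  have hpos : 0 < 2 ^ (n - 1) := by positivity
  obtain ⟨m, hm⟩ : ∃ m, 2 ^ (n - 1) = m + 1 := ⟨2 ^ (n - 1) - 1, by omega⟩
  have h : ∀ m', m' = m + 1 → (gammaQ n ^ m') (NormQ.base n k) = -NormQ.base n k := by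
    rintro _ rfl
    rw [pow_succ', AlgHom.mul_apply, gammaQ_pow_base n k m (by omega), gammaQ,
      MvPolynomial.aeval_X]
    simp [hm]
  exact h _ hm

/-- The inclusion `ℛ_r ⊗ ℚ → ℛ_n ⊗ ℚ`, `1 ≤ r ≤ n`: it sends `ℓ_k` to `ℓ_k` and is equivariant for
the subgroup `C_{2^r}` of `C_{2^n}`, whose generator is `γ_r = γ_n ^ (2 ^ (n - r))`. -/
noncomputable def inclQ (r n : ℕ) : NormQ r →ₐ[ℚ] NormQ n :=
  MvPolynomial.aeval fun p => (gammaQ n ^ (2 ^ (n - r) * p.1.val)) (NormQ.base n p.2)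

theorem inclQ_comp_gammaQ {r n : ℕ} (hr : 1 ≤ r) (hrn : r ≤ n) :
    (inclQ r n).comp (gammaQ r) = (gammaQ n ^ 2 ^ (n - r)).comp (inclQ r n) := by
  have hpow : 2 ^ (n - r) * 2 ^ (r - 1) = 2 ^ (n - 1) := by
    rw [← pow_add]; congr 1; omega
  refine MvPolynomial.algHom_ext fun p => ?_
  obtain ⟨⟨i, hi⟩, k⟩ := p
  simp only [AlgHom.comp_apply, gammaQ, inclQ, MvPolynomial.aeval_X]
  split_ifs with h
  · rw [MvPolynomial.aeval_X, ← AlgHom.mul_apply, ← pow_add]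
    congr 2
    ring
  · have hi' : i + 1 = 2 ^ (r - 1) := by omega
    rw [← AlgHom.mul_apply, ← pow_add, ← mul_one_add, add_comm 1 i, hi', hpow]
    have := gammaQ_pow_half n k
    rw [gammaQ] at this
    rw [this]
    simp [NormQ.base]

theorem inclQ_comp_unitQ {r n : ℕ} (hr : 1 ≤ r) (hrn : r ≤ n) (i : ℕ) :
    (inclQ r n).comp (unitQ r i) = unitQ n (2 ^ (n - r) * i) := by
  have h : ∀ i, ∀ x, inclQ r n ((gammaQ r ^ i) x) =
      (gammaQ n ^ (2 ^ (n - r) * i)) (inclQ r n x) := by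
    intro i
    induction i with
    | zero => intro x; simp
    | succ i ih =>
      intro x
      rw [pow_succ', AlgHom.mul_apply, ← AlgHom.comp_apply, inclQ_comp_gammaQ hr hrn,
        AlgHom.comp_apply, ih, ← AlgHom.mul_apply, ← pow_add, Nat.mul_succ, add_comm]
  refine MvPolynomial.algHom_ext fun k => ?_
  simp only [AlgHom.comp_apply, unitQ, MvPolynomial.aeval_X, h]
  simp [inclQ, NormQ.base]

/-- The inclusion `ℛ_r → ℛ_n` induced by the left units, `1 ≤ r ≤ n`. -/
noncomputable def incl (r n : ℕ) (hr : 1 ≤ r) (hrn : r ≤ n) : R r →+* R n :=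
  (inclQ r n : NormQ r →+* NormQ n).restrict (R r) (R n)
    fun _ h => map_mem_R (inclQ r n) (2 ^ (n - r) * ·) (inclQ_comp_unitQ hr hrn) h

/-- The formal group law `ℱ` over `ℛ_n`. -/
noncomputable def F (n : ℕ) : FormalGroup (R n) :=
  (fglQ n 0).toSubring (R n) (fglQ_coeff_mem n 0)

theorem F_map_subtype (n : ℕ) : (F n).map (R n).subtype = fglQ n 0 := rfl

theorem F_map_gamma_map_subtype (n : ℕ) :
    ((F n).map (gamma n)).map (R n).subtype = fglQ n 1 := by
  have h : (gammaQ n : NormQ n →+* NormQ n).comp (unitQ n 0 : BPQ →+* NormQ n) =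
      (unitQ n 1 : BPQ →+* NormQ n) := by
    rw [← gammaQ_comp_unitQ n 0]; rfl
  ext d
  simp only [fglQ, FormalGroup.map_toPowerSeries, MvPowerSeries.coeff_map, ← h]
  rfl

/-- The canonical strict isomorphism `ψ_{γ_n} : ℱ → ℱ^{γ_n}` over `ℛ_n`, where `ℱ^{γ_n}` is
obtained by applying the action of `γ_n` to the coefficients of `ℱ`. -/
noncomputable def psi (n : ℕ) : StrictIso (F n) ((F n).map (gamma n)) :=
  (psiQ n 0 1).toSubring (F_map_subtype n) (F_map_gamma_map_subtype n) (psiQ_coeff_mem n 0 1)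

/-- The generators `t_k^{C_{2^n}}` in `ℛ_n`: the coefficients in
`ψ_{γ_n} (x) = ∑^{ℱ^{γ_n}}_{k ≥ 0} t_k^{C_{2^n}} x ^ (2 ^ k)`. -/
noncomputable def t (n k : ℕ) : R n :=
  expansionCoeff ((F n).map (gamma n)) (psi n).toPowerSeries k

/-- The Araki generators `v_k`, as elements of `ℛ_n`: the coefficients in
`[2]_ℱ (x) = ∑^ℱ_{k ≥ 0} v_k x ^ (2 ^ k)`. -/
noncomputable def v (n k : ℕ) : R n :=
  expansionCoeff (F n) (F n).twoSeries k

/-- The ideal `I_k = (2, v_1, …, v_{k-1})` of `ℛ_n`. -/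
noncomputable def I (n k : ℕ) : Ideal (R n) :=
  Ideal.span ({2} ∪ {a | ∃ i, 1 ≤ i ∧ i < k ∧ a = v n i})

end BPNorm

/-!
Over `ℛ_n ⊗ ℚ` the law `ℱ^(γ^i)` has a 2-typical logarithm `l_i`, one in which only the powers
`x ^ (2 ^ m)` occur.  A series `c` has an expansion `∑^{ℱ^(γ^i)} c_j x ^ (2 ^ j)` as soon as
`l_i (c)` is 2-typical, and the coefficients `c_j` lie in any subring over which `ℱ^(γ^i)` and `c`
are defined (`FormalGroup.IsTypicalLog.hasFormalSum`).  This covers `ψ_γ`, since `l_1 (ψ_γ) = l_0`,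
and the 2-series, since `l_0 ([2]_ℱ) = 2 l_0`.

The congruences rest on one fact: modulo `I_k` the law `ℱ` is additive below total degree `2 ^ k`
(`BPNorm.isAdditiveBelow_F`).  It comes from Hazewinkel's functional equation
`l (x) = x + ∑_{i ≥ 1} (w_i / 2) (σ^i l) (x ^ (2 ^ i))`, where the `w_i` are the Hazewinkel
generators and `σ` is the ring endomorphism with `σ (w_i) = w_i ^ 2`.  As `σ` lifts the Frobenius of
the ring generated by the `w_i`, an induction on the degree shows that the coefficients of
`ℱ (x, y) - x - y` below degree `2 ^ k` are combinations of `w_1, …, w_{k-1}` over that ring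
(`BPNorm.exists_coeff_fglBP`).  Finally `w_i ≡ v_i` modulo `2` (`BPNorm.exists_unitQ_hazewinkel`).

If a law is additive below degree `2 ^ k`, then formal sums `∑ a_i x ^ (2 ^ i)` are ordinary sums up
to degree `2 ^ k` (`FormalGroup.HasFormalSum.coeff_eq_sum`).  In particular modulo `I_k` the
2-series starts with `v_k x ^ (2 ^ k)`; it is carried to the 2-series of `ℱ^γ` by `ψ_γ`, whence
`γ I_k ⊆ I_k` (`BPNorm.gamma_mem_I`), and all the laws `ℱ^(γ^i)` are additive modulo `I_k` in this
range.  The recursion formula is now the comparison of the coefficients of `x ^ (2 ^ k)` in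
`ψ_{γ^2} = (γ ψ_γ) ∘ ψ_γ`, over a ring of characteristic `2`.  For `n = 1` one has
`l_1 (x) = -l_0 (-x)`, so that `ψ_γ = -[-1]_ℱ`, and the coefficients of `x ^ (2 ^ k)` in `-[-1]_ℱ`
and `[2]_ℱ` agree modulo `I_k`.
-/

/-! ### Power series: orders, and substitution into 2-typical series -/

namespace MvPowerSeries

variable {σ A : Type*} [CommRing A]

theorem one_le_order {f : MvPowerSeries σ A} (hf : f.constantCoeff = 0) : 1 ≤ f.order :=
  one_le_order_iff_constCoeff_eq_zero.mpr hf

/-- Two series without constant term that agree below degree `N` have `(s + 1)`-st powers that agree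
below degree `N + s`. -/
theorem le_order_pow_sub_pow {f g : MvPowerSeries σ A} (hf : f.constantCoeff = 0)
    (hg : g.constantCoeff = 0) {N : ℕ} (h : N ≤ (f - g).order) (s : ℕ) :
    ((N + s : ℕ) : ℕ∞) ≤ (f ^ (s + 1) - g ^ (s + 1)).order := by
  induction s with
  | zero => simpa using h
  | succ s ih =>
    have : f ^ (s + 1 + 1) - g ^ (s + 1 + 1) =
        f * (f ^ (s + 1) - g ^ (s + 1)) + (f - g) * g ^ (s + 1) := by ring
    rw [this]
    refine (le_min ?_ ?_).trans min_order_le_add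
    · refine le_trans ?_ le_order_mul
      rw [show ((N + (s + 1) : ℕ) : ℕ∞) = 1 + ((N + s : ℕ) : ℕ∞) by push_cast; ring]
      exact add_le_add (one_le_order hf) ih
    · refine le_trans ?_ le_order_mul
      rw [Nat.cast_add]
      exact add_le_add h (le_order_pow_of_constantCoeff_eq_zero _ hg)

end MvPowerSeries

namespace PowerSeries

variable {σ A : Type*} [CommRing A]

/-- A power series in which only the powers `x ^ (2 ^ m)` occur. -/
def IsTypical (l : PowerSeries A) : Prop := ∀ d, (∀ m, d ≠ 2 ^ m) → l.coeff d = 0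

theorem IsTypical.map {B : Type*} [CommRing B] {l : PowerSeries A} (hl : l.IsTypical)
    (φ : A →+* B) : (l.map φ).IsTypical := fun d hd => by
  rw [coeff_map, hl d hd, map_zero]

theorem IsTypical.constantCoeff_eq_zero {l : PowerSeries A} (hl : l.IsTypical) :
    l.constantCoeff = 0 := by
  rw [← coeff_zero_eq_constantCoeff_apply]
  exact hl 0 fun m => (pow_pos two_pos m).ne

/-- Below degree `2 ^ (M + 1)`, a series in which only the powers `x ^ (2 ^ m)` occur may be
evaluated by its first `M + 1` terms. -/
theorem coeff_subst_eq_sum_two_pow {l : PowerSeries A} {z : MvPowerSeries σ A}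
    (hz : z.constantCoeff = 0) {M : ℕ} {d : σ →₀ ℕ} (hd : d.degree < 2 ^ (M + 1))
    (hl : ∀ e ≤ d.degree, (∀ m, e ≠ 2 ^ m) → l.coeff e = 0) :
    (l.subst z).coeff d =
      ∑ m ∈ Finset.range (M + 1), l.coeff (2 ^ m) * (z ^ 2 ^ m).coeff d := by
  rw [PowerSeries.coeff_subst (.of_constantCoeff_zero hz),
    finsum_eq_sum_of_support_subset (s := (Finset.range (M + 1)).image (2 ^ ·)),
    Finset.sum_image fun a _ b _ h => Nat.pow_right_injective le_rfl h]
  · rfl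
  · intro e he
    rw [Function.mem_support] at he
    have hed : e ≤ d.degree := by
      by_contra! hlt
      refine he ?_
      rw [MvPowerSeries.coeff_of_lt_order, smul_zero]
      exact lt_of_lt_of_le (by exact_mod_cast hlt)
        (MvPowerSeries.le_order_pow_of_constantCoeff_eq_zero _ hz)
    obtain ⟨m, rfl⟩ : ∃ m, e = 2 ^ m := by
      by_contra! h
      exact he (by rw [hl e hed h, zero_smul])
    refine Finset.mem_coe.mpr (Finset.mem_image.mpr ⟨m, Finset.mem_range.mpr ?_, rfl⟩)
    exact (Nat.pow_lt_pow_iff_right one_lt_two).mp (hed.trans_lt hd)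

theorem IsTypical.coeff_subst {l : PowerSeries A} (hl : l.IsTypical) {z : MvPowerSeries σ A}
    (hz : z.constantCoeff = 0) {M : ℕ} {d : σ →₀ ℕ} (hd : d.degree < 2 ^ (M + 1)) :
    (l.subst z).coeff d =
      ∑ m ∈ Finset.range (M + 1), l.coeff (2 ^ m) * (z ^ 2 ^ m).coeff d :=
  coeff_subst_eq_sum_two_pow hz hd fun e _ => hl e

/-- If `l (x) = l_1 x + ⋯` and `p`, `q` agree below degree `N`, then `l (p)` and `l (q)` differ in
degree `N` by `l_1` times the difference of `p` and `q`. -/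
theorem coeff_subst_sub_coeff_subst (l : PowerSeries A) {p q : PowerSeries A}
    (hp : p.constantCoeff = 0) (hq : q.constantCoeff = 0) {N : ℕ}
    (h : ∀ d < N, p.coeff d = q.coeff d) :
    coeff N (l.subst p) - coeff N (l.subst q) = l.coeff 1 * (p.coeff N - q.coeff N) := by
  have hp' := HasSubst.of_constantCoeff_zero' hp
  have hq' := HasSubst.of_constantCoeff_zero' hq
  have hord : (N : ℕ∞) ≤ MvPowerSeries.order (p - q) := by
    rw [← order_eq_order]
    exact nat_le_order _ _ fun i hi => by rw [map_sub, h i hi, sub_self]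
  rw [coeff_subst' hp', coeff_subst' hq',
    ← finsum_sub_distrib (coeff_subst_finite' hp' l N) (coeff_subst_finite' hq' l N),
    finsum_eq_single _ 1]
  · simp [mul_sub]
  · intro e he
    rw [← smul_sub, ← map_sub]
    rcases e with _ | _ | e
    · simp
    · exact absurd rfl he
    · have h0 : coeff N (p ^ (e + 1 + 1) - q ^ (e + 1 + 1)) = 0 := by
        refine coeff_of_lt_order _ ?_
        rw [order_eq_order]
        refine lt_of_lt_of_le ?_ (MvPowerSeries.le_order_pow_sub_pow hp hq hord (e + 1))
        exact_mod_cast (by omega : N < N + (e + 1))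
      rw [h0, smul_zero]

/-- Power series that agree after substitution into `l (x) = x + ⋯` in all degrees `< N` agree in
all degrees `< N`. -/
theorem coeff_eq_of_coeff_subst_eq {l : PowerSeries A} (hl : l.coeff 1 = 1) {p q : PowerSeries A}
    (hp : p.constantCoeff = 0) (hq : q.constantCoeff = 0) {N : ℕ}
    (h : ∀ d < N, coeff d (l.subst p) = coeff d (l.subst q)) : ∀ d < N, p.coeff d = q.coeff d := by
  intro d
  induction d using Nat.strong_induction_on with
  | _ d ih =>
    intro hd
    have := coeff_subst_sub_coeff_subst l hp hq fun e he => ih e he (he.trans hd)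
    rw [h d hd, sub_self, hl, one_mul] at this
    exact (sub_eq_zero.mp this.symm)

theorem eq_of_subst_eq {l : PowerSeries A} (hl : l.coeff 1 = 1) {p q : PowerSeries A}
    (hp : p.constantCoeff = 0) (hq : q.constantCoeff = 0) (h : l.subst p = l.subst q) : p = q := by
  ext d
  exact coeff_eq_of_coeff_subst_eq hl hp hq (N := d + 1) (fun _ _ => by rw [h]) d d.lt_succ_self

theorem constantCoeff_C_mul_X_pow (a : A) {s : ℕ} (hs : s ≠ 0) :
    (C a * X ^ s : PowerSeries A).constantCoeff = 0 := by
  simp [hs]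

theorem coeff_subst_C_mul_X_pow (l : PowerSeries A) (a : A) {s : ℕ} (hs : s ≠ 0) (e : ℕ) :
    coeff (s * e) (l.subst (C a * X ^ s : PowerSeries A)) = l.coeff e * a ^ e := by
  rw [coeff_subst' (.of_constantCoeff_zero' (constantCoeff_C_mul_X_pow a hs)), finsum_eq_single _ e]
  · rw [mul_pow, ← map_pow, ← pow_mul, coeff_C_mul, coeff_X_pow_self, mul_one, smul_eq_mul]
  · intro e' he'
    rw [mul_pow, ← map_pow, ← pow_mul, coeff_C_mul, coeff_X_pow, if_neg, mul_zero, smul_zero]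
    intro h
    exact he' (Nat.eq_of_mul_eq_mul_left (Nat.pos_of_ne_zero hs) h).symm

theorem coeff_subst_C_mul_X_pow_of_not_dvd (l : PowerSeries A) (a : A) {s : ℕ} (hs : s ≠ 0) {d : ℕ}
    (hd : ¬ s ∣ d) : coeff d (l.subst (C a * X ^ s : PowerSeries A)) = 0 := by
  rw [coeff_subst' (.of_constantCoeff_zero' (constantCoeff_C_mul_X_pow a hs)),
    finsum_eq_zero_of_forall_eq_zero]
  intro e
  rw [mul_pow, ← map_pow, ← pow_mul, coeff_C_mul, coeff_X_pow, if_neg, mul_zero, smul_zero]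
  rintro rfl
  exact hd (dvd_mul_right _ _)

/-- In characteristic `2`, taking `2 ^ j`-th powers raises coefficients to the same power. -/
theorem coeff_pow_two_pow [CharP A 2] (f : PowerSeries A) (j d : ℕ) :
    (f ^ 2 ^ j).coeff (2 ^ j * d) = f.coeff d ^ 2 ^ j := by
  have h := MvPowerSeries.map_iterateFrobenius_expand 2 two_ne_zero
    (show MvPowerSeries Unit A from f) j
  have h' := congrArg (MvPowerSeries.coeff (2 ^ j • Finsupp.single () d)) h
  rw [MvPowerSeries.coeff_map, MvPowerSeries.coeff_expand_smul, iterateFrobenius_def,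
    Finsupp.smul_single, smul_eq_mul] at h'
  exact h'.symm

end PowerSeries

/-! ### The functional equation of the logarithm -/

namespace BPNorm

open Finset

/-- The Hazewinkel generators, defined by `2 ℓ_m = ∑_{0 ≤ i < m} ℓ_i w_{m-i} ^ (2 ^ i)`; here
`w_0 = 2` is a convention without significance. -/
noncomputable def hazewinkel (m : ℕ) : BPQ :=
  2 * ell m - ∑ i : Fin (m - 1), ell (i + 1) * hazewinkel (m - (i + 1)) ^ 2 ^ (i.val + 1)
termination_by m
decreasing_by omega

theorem two_mul_ell (m : ℕ) :
    2 * ell (m + 1) = ∑ i ∈ range (m + 1), ell i * hazewinkel (m + 1 - i) ^ 2 ^ i := by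
  have h : hazewinkel (m + 1) = 2 * ell (m + 1) -
      ∑ i ∈ range m, ell (i + 1) * hazewinkel (m + 1 - (i + 1)) ^ 2 ^ (i + 1) := by
    rw [hazewinkel]
    exact congrArg _ (Fin.sum_univ_eq_sum_range
      (fun i => ell (i + 1) * hazewinkel (m + 1 - (i + 1)) ^ 2 ^ (i + 1)) m)
  rw [sum_range_succ', Nat.sub_zero, h]
  simp [ell]

/-- The values on the `ℓ_m` of the ring endomorphism that squares the Hazewinkel generators. -/
noncomputable def frobEll (m : ℕ) : BPQ :=
  if m = 0 then 1 else
    MvPolynomial.C (1 / 2) * ∑ i : Fin m, frobEll i * hazewinkel (m - i) ^ 2 ^ (i.val + 1)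
termination_by m
decreasing_by omega

/-- The ring endomorphism of `π_* BP ⊗ ℚ` that squares the Hazewinkel generators. -/
noncomputable def frob : BPQ →+* BPQ :=
  (MvPolynomial.aeval fun k => frobEll (k + 1) : BPQ →ₐ[ℚ] BPQ)

theorem frob_ell (m : ℕ) : frob (ell m) = frobEll m := by
  rcases m with _ | m
  · rw [frobEll]; simp [ell]
  · simp [frob, ell]

theorem two_mul_frob_ell (m : ℕ) : 2 * frob (ell (m + 1)) =
    ∑ i ∈ range (m + 1), frob (ell i) * hazewinkel (m + 1 - i) ^ 2 ^ (i + 1) := by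
  have h2 : (2 : BPQ) * MvPolynomial.C (1 / 2) = 1 := by
    rw [← map_ofNat (MvPolynomial.C : ℚ →+* BPQ) 2, ← map_mul]; norm_num
  rw [frob_ell, frobEll, if_neg m.succ_ne_zero, ← mul_assoc, h2, one_mul,
    Fin.sum_univ_eq_sum_range (fun i => frobEll i * hazewinkel (m + 1 - i) ^ 2 ^ (i + 1))]
  simp only [frob_ell]

theorem frob_hazewinkel (m : ℕ) : frob (hazewinkel (m + 1)) = hazewinkel (m + 1) ^ 2 := by
  induction m using Nat.strong_induction_on with
  | _ m ih =>
    have h1 := congrArg frob (two_mul_ell m)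
    rw [map_mul, map_ofNat, two_mul_frob_ell, map_sum, sum_range_succ', sum_range_succ'] at h1
    have h2 : ∑ i ∈ range m, frob (ell (i + 1) * hazewinkel (m + 1 - (i + 1)) ^ 2 ^ (i + 1)) =
        ∑ i ∈ range m, frob (ell (i + 1)) * hazewinkel (m + 1 - (i + 1)) ^ 2 ^ (i + 1 + 1) := by
      refine sum_congr rfl fun i hi => ?_
      have hi := mem_range.mp hi
      obtain ⟨j, hj⟩ : ∃ j, m + 1 - (i + 1) = j + 1 := ⟨m - i - 1, by omega⟩
      rw [map_mul, map_pow, hj, ih j (by omega), ← pow_mul, ← pow_succ']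
    rw [h2] at h1
    simpa [ell] using (add_left_cancel h1).symm

/-- The logarithm satisfies `2 l (x) = 2 x + ∑_{i ≥ 1} w_i (σ ^ i l) (x ^ (2 ^ i))`, where `σ`
squares the Hazewinkel generators. -/
theorem two_mul_ell' (m : ℕ) : 2 * ell (m + 1) =
    ∑ i ∈ range (m + 1), hazewinkel (i + 1) * (frob ^ (i + 1)) (ell (m - i)) := by
  induction m using Nat.strong_induction_on with
  | _ m ih =>
    have h2 : (2 : BPQ) ≠ 0 := two_ne_zero
    apply mul_left_cancel₀ h2
    -- Expand each `ℓ_i` in the recursion for `ℓ_{m+1}` by induction; exchanging the sums turns the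
    -- sum over `i` into `σ ^ (a + 1)` applied to the recursion for a smaller index.
    have hL : 2 * (2 * ell (m + 1)) = 2 * hazewinkel (m + 1) + ∑ i ∈ range m,
        ∑ a ∈ range (i + 1), hazewinkel (a + 1) * (frob ^ (a + 1)) (ell (i - a)) *
          hazewinkel (m - i) ^ 2 ^ (i + 1) := by
      rw [two_mul_ell, sum_range_succ', mul_add, mul_sum, add_comm]
      congr 1
      · simp [ell]
      · refine sum_congr rfl fun i hi => ?_
        rw [← mul_assoc, ih i (mem_range.mp hi), sum_mul, Nat.add_sub_add_right]
    have hR : ∀ a ∈ range m, 2 * (hazewinkel (a + 1) * (frob ^ (a + 1)) (ell (m - a))) =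
        ∑ i ∈ range (m - a), hazewinkel (a + 1) * (frob ^ (a + 1)) (ell i) *
          hazewinkel (m - a - i) ^ 2 ^ (a + i + 1) := by
      intro a ha
      have ha := mem_range.mp ha
      obtain ⟨b, hb⟩ : ∃ b, m - a = b + 1 := ⟨m - a - 1, by omega⟩
      have h := congrArg (frob ^ (a + 1)) (two_mul_ell b)
      rw [map_mul, map_ofNat, map_sum] at h
      have hp : ∀ c j : ℕ, (frob ^ c) (hazewinkel (j + 1)) = hazewinkel (j + 1) ^ 2 ^ c := by
        intro c j
        induction c with
        | zero => simp
        | succ c ihc =>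
          rw [pow_succ, RingHom.mul_def, RingHom.comp_apply, frob_hazewinkel, map_pow, ihc,
            ← pow_mul, pow_succ]
      rw [hb, mul_left_comm, h, mul_sum]
      refine sum_congr rfl fun i hi => ?_
      have hi := mem_range.mp hi
      obtain ⟨j, hj⟩ : ∃ j, b + 1 - i = j + 1 := ⟨b - i, by omega⟩
      rw [map_mul, map_pow, hj, hp, ← pow_mul, ← pow_add, mul_assoc]
      congr 4
      omega
    rw [hL, mul_sum, sum_range_succ, sum_congr rfl hR, add_comm]
    congr 1
    · rw [sum_sigma', sum_sigma']
      refine sum_bij' (fun x _ => ⟨x.2, x.1 - x.2⟩) (fun x _ => ⟨x.1 + x.2, x.1⟩) ?_ ?_ ?_ ?_ ?_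
      all_goals
        rintro ⟨a, b⟩ h
        simp only [mem_sigma, mem_range] at h ⊢
      · omega
      · omega
      · simp only [Sigma.mk.injEq, heq_eq_eq, and_true]; omega
      · simp only [Sigma.mk.injEq, heq_eq_eq, true_and]; omega
      · rw [show m - b - (a - b) = m - a by omega, show b + (a - b) + 1 = a + 1 by omega]
    · simp [ell]

end BPNorm

/-! ### Frobenius lifts on power series -/

namespace MvPowerSeries

variable {σ A B : Type*} [CommRing A] [CommRing B]

/-- The ring endomorphism of `A⟦X⟧` that is `f` on the coefficients and squares the variables. -/
noncomputable def squareVars (f : A →+* A) : MvPowerSeries σ A →+* MvPowerSeries σ A :=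
  (expand 2 two_ne_zero : MvPowerSeries σ A →ₐ[A] MvPowerSeries σ A).toRingHom.comp (map f)

theorem squareVars_C (f : A →+* A) (a : A) :
    squareVars f (C a : MvPowerSeries σ A) = C (f a) := by
  simp [squareVars, expand_C]

theorem pow_squareVars_C (f : A →+* A) (i : ℕ) (a : A) :
    (squareVars f ^ i) (C a : MvPowerSeries σ A) = C ((f ^ i) a) := by
  induction i with
  | zero => simp
  | succ i ih =>
    rw [pow_succ', RingHom.mul_def, RingHom.comp_apply, ih, squareVars_C, pow_succ',
      RingHom.mul_def, RingHom.comp_apply]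

theorem map_squareVars {ι : A →+* B} {f : A →+* A} {g : B →+* B} (h : ι.comp f = g.comp ι)
    (p : MvPowerSeries σ A) : map ι (squareVars f p) = squareVars g (map ι p) := by
  simp only [squareVars, RingHom.comp_apply, AlgHom.toRingHom_eq_coe, RingHom.coe_coe, map_expand]
  rw [← RingHom.comp_apply (map ι), ← map_comp, h, map_comp, RingHom.comp_apply]

theorem map_pow_squareVars {ι : A →+* B} {f : A →+* A} {g : B →+* B} (h : ι.comp f = g.comp ι)
    (i : ℕ) (p : MvPowerSeries σ A) :
    map ι ((squareVars f ^ i) p) = (squareVars g ^ i) (map ι p) := by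
  induction i with
  | zero => simp
  | succ i ih =>
    rw [pow_succ', pow_succ', RingHom.mul_def, RingHom.mul_def, RingHom.comp_apply,
      map_squareVars h, ih, RingHom.comp_apply]

theorem le_order_pow_squareVars (f : A →+* A) (i : ℕ) {p : MvPowerSeries σ A} {n : ℕ}
    (h : n ≤ p.order) : ((2 ^ i * n : ℕ) : ℕ∞) ≤ ((squareVars f ^ i) p).order := by
  induction i with
  | zero => simpa using h
  | succ i ih =>
    rw [pow_succ' (squareVars f), RingHom.mul_def, RingHom.comp_apply]
    change _ ≤ (expand 2 two_ne_zero (map f _)).order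
    rw [order_expand, pow_succ', mul_assoc, Nat.cast_mul, nsmul_eq_mul]
    gcongr
    exact ih.trans (le_order_map _)

theorem two_dvd_of_coeff {p : MvPowerSeries σ A} (h : ∀ d, (2 : A) ∣ p.coeff d) : 2 ∣ p := by
  choose q hq using h
  let Q : MvPowerSeries σ A := q
  have hQ : ∀ d, Q.coeff d = q d := fun _ => rfl
  refine ⟨Q, ?_⟩
  ext d
  rw [hq d, ← map_ofNat (C : A →+* MvPowerSeries σ A) 2, coeff_C_mul, hQ]

/-- If `f` lifts the Frobenius of `A / 2`, then `squareVars f` lifts the Frobenius of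
`A⟦X⟧ / 2`. -/
theorem two_dvd_sq_sub_squareVars {f : A →+* A} (hf : ∀ a, (2 : A) ∣ a ^ 2 - f a)
    (p : MvPowerSeries σ A) : 2 ∣ p ^ 2 - squareVars f p := by
  refine two_dvd_of_coeff fun d => ?_
  let π := Ideal.Quotient.mk (Ideal.span {(2 : A)})
  rw [← Ideal.mem_span_singleton, ← Ideal.Quotient.eq_zero_iff_mem]
  rcases subsingleton_or_nontrivial (A ⧸ Ideal.span {(2 : A)}) with hs | hs
  · exact Subsingleton.elim _ _
  · have h2 : (2 : A ⧸ Ideal.span {(2 : A)}) = 0 :=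
      Ideal.Quotient.eq_zero_iff_mem.mpr (Ideal.mem_span_singleton_self 2)
    have : CharP (A ⧸ Ideal.span {(2 : A)}) 2 :=
      CharTwo.of_one_ne_zero_of_two_eq_zero one_ne_zero h2
    have hπ : (frobenius _ 2).comp π = π.comp f := by
      ext a
      rw [RingHom.comp_apply, RingHom.comp_apply, frobenius_def, ← map_pow, ← sub_eq_zero,
        ← map_sub]
      exact Ideal.Quotient.eq_zero_iff_mem.mpr (Ideal.mem_span_singleton.mpr (hf a))
    have key : map π (p ^ 2 - squareVars f p) = 0 := by
      rw [map_sub, map_pow, ← map_frobenius_expand 2 two_ne_zero, ← map_expand,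
        ← RingHom.comp_apply, ← map_comp, hπ, map_expand, map_comp]
      simp [squareVars, map_expand]
    have := congrArg (coeff d) key
    rwa [coeff_map, map_zero] at this

theorem two_dvd_pow_sub_pow_squareVars {f : A →+* A} (hf : ∀ a, (2 : A) ∣ a ^ 2 - f a)
    (p : MvPowerSeries σ A) (i : ℕ) : 2 ∣ p ^ 2 ^ i - (squareVars f ^ i) p := by
  induction i with
  | zero => simp
  | succ i ih =>
    have h : p ^ 2 ^ (i + 1) - (squareVars f ^ (i + 1)) p =
        (p ^ 2 ^ i - (squareVars f ^ i) p) * (p ^ 2 ^ i + (squareVars f ^ i) p) +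
        (((squareVars f ^ i) p) ^ 2 - squareVars f ((squareVars f ^ i) p)) := by
      rw [pow_succ' (squareVars f), RingHom.mul_def, RingHom.comp_apply]
      ring
    rw [h]
    exact dvd_add (ih.mul_right _) (two_dvd_sq_sub_squareVars hf _)

end MvPowerSeries

/-! ### The universal 2-typical formal group law over the ring of Hazewinkel generators -/

namespace BPNorm

open Finset

/-- The subring generated by the Hazewinkel generators. -/
noncomputable def hazewinkelRing : Subring BPQ :=
  Subring.closure (Set.range fun m => hazewinkel (m + 1))

theorem hazewinkel_mem (m : ℕ) : hazewinkel (m + 1) ∈ hazewinkelRing :=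
  Subring.subset_closure ⟨m, rfl⟩

theorem two_pow_mul_ell_mem (m : ℕ) : 2 ^ m * ell m ∈ hazewinkelRing := by
  induction m using Nat.strong_induction_on with
  | _ m ih =>
    rcases m with _ | m
    · simp [ell, one_mem]
    · rw [pow_succ, mul_assoc, two_mul_ell, mul_sum]
      refine sum_mem fun i hi => ?_
      have hi := mem_range.mp hi
      obtain ⟨j, hj⟩ : ∃ j, m + 1 - i = j + 1 := ⟨m - i, by omega⟩
      rw [hj, show m = (m - i) + i by omega, pow_add, mul_assoc, ← mul_assoc (2 ^ i)]
      exact mul_mem (pow_mem (ofNat_mem _ 2) _) (mul_mem (ih i hi) (pow_mem (hazewinkel_mem j) _))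

theorem frob_mem {a : BPQ} (ha : a ∈ hazewinkelRing) : frob a ∈ hazewinkelRing := by
  suffices hazewinkelRing ≤ hazewinkelRing.comap frob from this ha
  refine Subring.closure_le.mpr ?_
  rintro _ ⟨m, rfl⟩
  exact Subring.mem_comap.mpr (by rw [frob_hazewinkel]; exact pow_mem (hazewinkel_mem m) 2)

/-- The endomorphism `frob` of the subring generated by the Hazewinkel generators. -/
noncomputable def frobRing : hazewinkelRing →+* hazewinkelRing :=
  frob.restrict hazewinkelRing hazewinkelRing fun _ h => frob_mem h

theorem subtype_comp_frobRing :
    hazewinkelRing.subtype.comp frobRing = frob.comp hazewinkelRing.subtype := rfl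

theorem two_dvd_sq_sub_frobRing (a : hazewinkelRing) : 2 ∣ a ^ 2 - frobRing a := by
  obtain ⟨a, ha⟩ := a
  induction ha using Subring.closure_induction with
  | mem x hx =>
    obtain ⟨m, rfl⟩ := hx
    refine ⟨0, ?_⟩
    rw [mul_zero, sub_eq_zero]
    exact Subtype.ext (frob_hazewinkel m).symm
  | zero => exact ⟨0, Subtype.ext (by simp [frobRing])⟩
  | one => exact ⟨0, Subtype.ext (by simp [frobRing])⟩
  | add x y hx hy ihx ihy =>
    have h : (⟨x + y, add_mem hx hy⟩ : hazewinkelRing) = ⟨x, hx⟩ + ⟨y, hy⟩ := rfl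
    rw [h, map_add]
    have : ∀ a b c d : hazewinkelRing, (a + b) ^ 2 - (c + d) = (a ^ 2 - c) + (b ^ 2 - d) +
      2 * (a * b) := fun _ _ _ _ => by ring
    rw [this]
    exact dvd_add (dvd_add ihx ihy) (dvd_mul_right _ _)
  | neg x hx ihx =>
    have h : (⟨-x, neg_mem hx⟩ : hazewinkelRing) = -⟨x, hx⟩ := rfl
    rw [h, map_neg]
    have : ∀ a c : hazewinkelRing, (-a) ^ 2 - -c = 2 * a ^ 2 - (a ^ 2 - c) := fun _ _ => by ring
    rw [this]
    exact dvd_sub (dvd_mul_right _ _) ihx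
  | mul x y hx hy ihx ihy =>
    have h : (⟨x * y, mul_mem hx hy⟩ : hazewinkelRing) = ⟨x, hx⟩ * ⟨y, hy⟩ := rfl
    rw [h, map_mul]
    have : ∀ a b c d : hazewinkelRing,
        (a * b) ^ 2 - c * d = (a ^ 2 - c) * b ^ 2 + c * (b ^ 2 - d) := fun _ _ _ _ => by ring
    rw [this]
    exact dvd_add (ihx.mul_right _) (ihy.mul_left _)

/-- The series `∑_{m ≤ M} ℓ_m z ^ (2 ^ m)`, which is `logBP (z)` below degree `2 ^ (M + 1)`. -/
noncomputable def logPartial {σ : Type*} (M : ℕ) (z : MvPowerSeries σ BPQ) : MvPowerSeries σ BPQ :=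
  ∑ m ∈ range (M + 1), MvPowerSeries.C (ell m) * z ^ 2 ^ m

/-- `ℓ_j (f ^ (2 ^ (i + j)) - σ ^ i (f) ^ (2 ^ j))` is twice an integral series, because the
difference is divisible by `2 ^ (j + 1)` while `2 ^ j ℓ_j` is integral. -/
theorem exists_C_mul_pow_sub {σ : Type*} (f : MvPowerSeries σ hazewinkelRing) (i j : ℕ) :
    ∃ g : MvPowerSeries σ hazewinkelRing,
      MvPowerSeries.C ((frob ^ i) (ell j)) * (f.map hazewinkelRing.subtype) ^ 2 ^ (i + j) =
      MvPowerSeries.C ((frob ^ i) (ell j)) *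
        ((MvPowerSeries.squareVars frob ^ i) (f.map hazewinkelRing.subtype)) ^ 2 ^ j +
      2 * g.map hazewinkelRing.subtype := by
  obtain ⟨q, hq⟩ := dvd_sub_pow_of_dvd_sub (p := 2) (by
    exact_mod_cast MvPowerSeries.two_dvd_pow_sub_pow_squareVars two_dvd_sq_sub_frobRing f i) j
  have hmem : ∀ i, 2 ^ j * (frob ^ i) (ell j) ∈ hazewinkelRing := by
    intro i
    induction i with
    | zero => exact two_pow_mul_ell_mem j
    | succ i ih =>
      have h := frob_mem ih
      rw [map_mul, map_pow, map_ofNat] at h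
      rwa [pow_succ', RingHom.mul_def, RingHom.comp_apply]
  refine ⟨MvPowerSeries.C ⟨_, hmem i⟩ * q, ?_⟩
  have h := congrArg (MvPowerSeries.map hazewinkelRing.subtype) hq
  rw [map_sub, map_pow, map_pow, map_pow, MvPowerSeries.map_pow_squareVars subtype_comp_frobRing,
    ← pow_mul, ← pow_add, map_mul, map_pow, map_natCast, Nat.cast_ofNat] at h
  rw [sub_eq_iff_eq_add.mp h, map_mul, MvPowerSeries.map_C, Subring.subtype_apply, map_mul, map_pow,
    map_ofNat]
  ring

/-- The functional equation of the logarithm, up to integral multiples of the generators. -/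
theorem exists_two_mul_logPartial_sub {σ : Type*} (f : MvPowerSeries σ hazewinkelRing) (M : ℕ) :
    ∃ g : ℕ → MvPowerSeries σ hazewinkelRing,
      2 * (logPartial M (f.map hazewinkelRing.subtype) - f.map hazewinkelRing.subtype) =
      ∑ i ∈ range M, MvPowerSeries.C (hazewinkel (i + 1)) *
        ((MvPowerSeries.squareVars frob ^ (i + 1))
          (logPartial (M - 1 - i) (f.map hazewinkelRing.subtype)) +
          2 * (g i).map hazewinkelRing.subtype) := by
  choose g hg using fun i j => exists_C_mul_pow_sub f (i + 1) j
  set z := f.map hazewinkelRing.subtype with hz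
  refine ⟨fun i => ∑ j ∈ range (M - i), g i j, ?_⟩
  have hL : 2 * (logPartial M z - z) = ∑ m ∈ range M, ∑ i ∈ range (m + 1),
      MvPowerSeries.C (hazewinkel (i + 1)) *
        (MvPowerSeries.C ((frob ^ (i + 1)) (ell (m - i))) * z ^ 2 ^ (m + 1)) := by
    rw [logPartial, sum_range_succ']
    simp only [show ell 0 = 1 from rfl, map_one, pow_zero, pow_one, one_mul, add_sub_cancel_right]
    rw [mul_sum]
    refine sum_congr rfl fun m _ => ?_
    have h := congrArg (MvPowerSeries.C (σ := σ)) (two_mul_ell' m)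
    rw [map_mul, map_ofNat, map_sum] at h
    rw [← mul_assoc]
    change 2 * MvPowerSeries.C (ell (m + 1)) * _ = _
    rw [h, sum_mul]
    exact sum_congr rfl fun i _ => by rw [map_mul, mul_assoc]
  have hR : ∀ i ∈ range M, MvPowerSeries.C (hazewinkel (i + 1)) *
        ((MvPowerSeries.squareVars frob ^ (i + 1)) (logPartial (M - 1 - i) z) +
          2 * (∑ j ∈ range (M - i), g i j).map hazewinkelRing.subtype) =
      ∑ j ∈ range (M - i), MvPowerSeries.C (hazewinkel (i + 1)) *
        (MvPowerSeries.C ((frob ^ (i + 1)) (ell j)) * z ^ 2 ^ (i + 1 + j)) := by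
    intro i hi
    have hi := mem_range.mp hi
    rw [logPartial, show M - 1 - i + 1 = M - i by omega, map_sum, map_sum, mul_sum,
      ← sum_add_distrib, mul_sum]
    refine sum_congr rfl fun j _ => ?_
    rw [hg, map_mul, map_pow, MvPowerSeries.pow_squareVars_C]
  rw [hL, sum_congr rfl hR, sum_sigma', sum_sigma']
  refine sum_bij' (fun x _ => ⟨x.2, x.1 - x.2⟩) (fun x _ => ⟨x.1 + x.2, x.1⟩) ?_ ?_ ?_ ?_ ?_
  all_goals
    rintro ⟨a, b⟩ h
    simp only [mem_sigma, mem_range] at h ⊢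
  · omega
  · omega
  · simp only [Sigma.mk.injEq, heq_eq_eq, and_true]; omega
  · simp only [Sigma.mk.injEq, heq_eq_eq, true_and]; omega
  · rw [show b + 1 + (a - b) = a + 1 by omega]

end BPNorm

namespace BPNorm

open Finset FormalGroup

theorem logBP_isTypical : logBP.IsTypical := fun d hd => by
  rw [logBP, PowerSeries.coeff_mk, if_neg (hd _)]

theorem coeff_logBP (m : ℕ) : logBP.coeff (2 ^ m) = ell m := by
  rw [logBP, PowerSeries.coeff_mk, Nat.log_pow one_lt_two, if_pos rfl]

theorem logBP_subst_fglBP : logBP.subst fglBP.toPowerSeries =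
    logBP.subst (MvPowerSeries.X 0 : MvPowerSeries (Fin 2) BPQ) +
      logBP.subst (MvPowerSeries.X 1 : MvPowerSeries (Fin 2) BPQ) := by
  refine subst_subst_cancel expBP_zero logBP_expBP ?_
  have h0 (i : Fin 2) :
      (logBP.subst (MvPowerSeries.X i : MvPowerSeries (Fin 2) BPQ)).constantCoeff = 0 :=
    PowerSeries.constantCoeff_subst_eq_zero (by simp) _ logBP_zero
  rw [map_add, h0, h0, _root_.add_zero]

theorem coeff_logPartial {σ : Type*} {z : MvPowerSeries σ BPQ} (hz : z.constantCoeff = 0) {M : ℕ}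
    {d : σ →₀ ℕ} (hd : d.degree < 2 ^ (M + 1)) :
    (logPartial M z).coeff d = (logBP.subst z).coeff d := by
  rw [logBP_isTypical.coeff_subst hz hd, logPartial, map_sum]
  simp [coeff_logBP]

/-- If `y` and `z` agree below degree `N`, then the truncated logarithms of `y` and `z` differ in
degrees `≤ N` only by the linear term `y - z`. -/
theorem lt_order_logPartial_sub {σ : Type*} {y z : MvPowerSeries σ BPQ} (hy : y.constantCoeff = 0)
    (hz : z.constantCoeff = 0) {N : ℕ} (h : N ≤ (y - z).order) (M : ℕ) :
    (N : ℕ∞) < (logPartial M y - logPartial M z - (y - z)).order := by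
  have : logPartial M y - logPartial M z - (y - z) =
      ∑ m ∈ range M, MvPowerSeries.C (ell (m + 1)) * (y ^ 2 ^ (m + 1) - z ^ 2 ^ (m + 1)) := by
    rw [logPartial, logPartial, sum_range_succ', sum_range_succ']
    simp only [show ell 0 = 1 from rfl, map_one, pow_zero, pow_one, one_mul, mul_sub,
      sum_sub_distrib]
    ring
  rw [this]
  refine lt_of_lt_of_le (b := ((N + 1 : ℕ) : ℕ∞)) (by exact_mod_cast N.lt_succ_self) ?_
  refine MvPowerSeries.nat_le_order fun d hd => ?_
  rw [map_sum]
  refine sum_eq_zero fun m _ => ?_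
  rw [MvPowerSeries.coeff_C_mul, MvPowerSeries.coeff_of_lt_order, mul_zero]
  obtain ⟨s, hs⟩ : ∃ s, 2 ^ (m + 1) = s + 1 + 1 := by
    have := Nat.pow_le_pow_right two_pos (show 1 ≤ m + 1 by omega)
    exact ⟨2 ^ (m + 1) - 2, by omega⟩
  rw [hs]
  refine lt_of_lt_of_le ?_ (MvPowerSeries.le_order_pow_sub_pow hy hz h (s + 1))
  exact_mod_cast (by omega : d.degree < N + (s + 1))

/-- A coefficient of the universal 2-typical formal group law in a total degree between `2` and
`2 ^ (M + 1) - 1` is a combination of `w_1, …, w_M` over the ring that they generate.  In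
particular, the formal group law is defined over that ring. -/
theorem exists_coeff_fglBP (M : ℕ) {d : Fin 2 →₀ ℕ} (hd2 : 2 ≤ d.degree)
    (hd : d.degree < 2 ^ (M + 1)) : ∃ a : ℕ → hazewinkelRing,
      fglBP.toPowerSeries.coeff d = ∑ i ∈ range M, hazewinkel (i + 1) * a i := by
  obtain ⟨N, hN⟩ : ∃ N, d.degree = N := ⟨_, rfl⟩
  induction N using Nat.strong_induction_on generalizing d with
  | _ N ih =>
    subst hN
    set F := fglBP.toPowerSeries with hF
    set N := d.degree with hN
    have hmem : ∀ e : Fin 2 →₀ ℕ, e.degree < N → F.coeff e ∈ hazewinkelRing := by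
      intro e he
      rcases Nat.lt_or_ge e.degree 2 with h2 | h2
      · rcases Nat.lt_or_ge e.degree 1 with h1 | h1
        · have : e = 0 := (Finsupp.degree_eq_zero_iff e).mp (by omega)
          rw [this, MvPowerSeries.coeff_zero_eq_constantCoeff_apply, fglBP.zero_constantCoeff]
          exact zero_mem _
        · obtain ⟨i, rfl⟩ : ∃ i, e = Finsupp.single i 1 := by
            rw [Finsupp.degree_eq_sum, Fin.sum_univ_two] at h1 h2
            rcases Nat.eq_zero_or_pos (e 0) with h0 | h0
            · exact ⟨1, by ext j; fin_cases j <;> simp <;> omega⟩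
            · exact ⟨0, by ext j; fin_cases j <;> simp <;> omega⟩
          fin_cases i
          · exact fglBP.lin_coeff_X ▸ one_mem _
          · exact fglBP.lin_coeff_Y ▸ one_mem _
      · obtain ⟨a, ha⟩ := ih _ he h2 (he.trans hd) rfl
        rw [ha]
        exact sum_mem fun i _ => mul_mem (hazewinkel_mem i) (a i).2
    -- The truncation of the formal group law below degree `N`, as a series over the subring.
    let T' : MvPowerSeries (Fin 2) hazewinkelRing :=
      fun e => if h : e.degree < N then ⟨F.coeff e, hmem e h⟩ else 0
    set T : MvPowerSeries (Fin 2) BPQ := T'.map hazewinkelRing.subtype with hT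
    have hTc : ∀ e, T.coeff e = if e.degree < N then F.coeff e else 0 := by
      intro e
      change ((T' e : hazewinkelRing) : BPQ) = _
      simp only [T']
      split_ifs <;> rfl
    have hT0 : T.constantCoeff = 0 := by
      rw [← MvPowerSeries.coeff_zero_eq_constantCoeff_apply, hTc]
      simp [hF, fglBP.zero_constantCoeff]
    have hFT : (N : ℕ∞) ≤ (F - T).order := MvPowerSeries.nat_le_order fun e he => by
      rw [map_sub, hTc, if_pos he, sub_self]
    let X (i : Fin 2) : MvPowerSeries (Fin 2) BPQ := MvPowerSeries.X i
    have hX0 (i : Fin 2) : (X i).constantCoeff = 0 := MvPowerSeries.constantCoeff_X i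
    have hX (i : Fin 2) : (MvPowerSeries.X i : MvPowerSeries (Fin 2) hazewinkelRing).map
        hazewinkelRing.subtype = X i := MvPowerSeries.map_X _ i
    obtain ⟨g, hg⟩ := exists_two_mul_logPartial_sub T' M
    obtain ⟨g₀, hg₀⟩ := exists_two_mul_logPartial_sub
      (MvPowerSeries.X 0 : MvPowerSeries (Fin 2) hazewinkelRing) M
    obtain ⟨g₁, hg₁⟩ := exists_two_mul_logPartial_sub
      (MvPowerSeries.X 1 : MvPowerSeries (Fin 2) hazewinkelRing) M
    rw [hX] at hg₀ hg₁
    rw [← hT] at hg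
    -- Below degree `N` the series `l (T)` is `l (x) + l (y)`, so the substituted terms cancel.
    have hcancel : ∀ i ∈ range M, ((MvPowerSeries.squareVars frob ^ (i + 1))
        (logPartial (M - 1 - i) T - logPartial (M - 1 - i) (X 0) -
          logPartial (M - 1 - i) (X 1))).coeff d = 0 := by
      intro i hi
      have hi := mem_range.mp hi
      refine MvPowerSeries.coeff_of_lt_order (lt_of_lt_of_le ?_
        (MvPowerSeries.le_order_pow_squareVars frob (i + 1) (n := min N (2 ^ (M - i))) ?_))
      · rw [← hN]
        have h1 : 2 ≤ 2 ^ (i + 1) := by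
          simpa using Nat.pow_le_pow_right two_pos (show 1 ≤ i + 1 by omega)
        have h2 : N < 2 ^ (i + 1) * min N (2 ^ (M - i)) := by
          rcases min_choice N (2 ^ (M - i)) with h | h <;> rw [h]
          · nlinarith
          · rw [← pow_add, show i + 1 + (M - i) = M + 1 by omega]
            exact hd
        exact_mod_cast h2
      · refine MvPowerSeries.nat_le_order fun e he => ?_
        have he' : e.degree < 2 ^ (M - 1 - i + 1) := by
          rw [show M - 1 - i + 1 = M - i by omega]
          exact he.trans_le (min_le_right _ _)
        have heN : e.degree < N := he.trans_le (min_le_left _ _)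
        have hlt := MvPowerSeries.coeff_of_lt_order (f := logPartial (M - 1 - i) F -
          logPartial (M - 1 - i) T - (F - T)) (d := e) (lt_trans (by exact_mod_cast heN)
            (lt_order_logPartial_sub fglBP.zero_constantCoeff hT0 hFT _))
        rw [map_sub, map_sub, map_sub, hTc, if_pos heN, sub_self, sub_zero, sub_eq_zero,
          coeff_logPartial fglBP.zero_constantCoeff he', logBP_subst_fglBP, map_add] at hlt
        rw [map_sub, map_sub, ← hlt, coeff_logPartial (hX0 0) he', coeff_logPartial (hX0 1) he']
        ring
    have hXd (i : Fin 2) : (X i).coeff d = 0 := by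
      rw [MvPowerSeries.coeff_X, if_neg]
      rintro rfl
      simp [hN] at hd2
    have key : -(2 * F.coeff d) = ∑ i ∈ range M,
        hazewinkel (i + 1) * (2 * ((g i - g₀ i - g₁ i).coeff d : hazewinkelRing)) := by
      have hlt := MvPowerSeries.coeff_of_lt_order (f := logPartial M F - logPartial M T - (F - T))
        (d := d) (lt_order_logPartial_sub fglBP.zero_constantCoeff hT0 hFT _)
      rw [map_sub, map_sub, map_sub, coeff_logPartial fglBP.zero_constantCoeff hd,
        logBP_subst_fglBP, map_add, ← coeff_logPartial (hX0 0) hd,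
        ← coeff_logPartial (hX0 1) hd] at hlt
      have h := congrArg (MvPowerSeries.coeff d) (congrArg₂ (· - ·) (congrArg₂ (· - ·) hg hg₀) hg₁)
      have hl : ∀ z : MvPowerSeries (Fin 2) BPQ, (2 * z).coeff d = 2 * z.coeff d := fun z => by
        rw [two_mul, map_add, two_mul]
      rw [map_sub, map_sub, hl, hl, hl, map_sub, map_sub, map_sub, hXd, hXd, hTc,
        if_neg (lt_irrefl _), sub_zero, sub_zero, sub_zero, ← sum_sub_distrib, ← sum_sub_distrib,
        map_sum] at h
      rw [hTc, if_neg (lt_irrefl _)] at hlt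
      have hs : ∀ i ∈ range M, (MvPowerSeries.C (hazewinkel (i + 1)) *
            ((MvPowerSeries.squareVars frob ^ (i + 1)) (logPartial (M - 1 - i) T) +
              2 * (g i).map hazewinkelRing.subtype) -
          MvPowerSeries.C (hazewinkel (i + 1)) *
            ((MvPowerSeries.squareVars frob ^ (i + 1)) (logPartial (M - 1 - i) (X 0)) +
              2 * (g₀ i).map hazewinkelRing.subtype) -
          MvPowerSeries.C (hazewinkel (i + 1)) *
            ((MvPowerSeries.squareVars frob ^ (i + 1)) (logPartial (M - 1 - i) (X 1)) +
              2 * (g₁ i).map hazewinkelRing.subtype)).coeff d =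
          hazewinkel (i + 1) * (2 * ((g i - g₀ i - g₁ i).coeff d : hazewinkelRing)) := by
        intro i hi
        have hc := hcancel i hi
        rw [← mul_sub, ← mul_sub, MvPowerSeries.coeff_C_mul]
        congr 1
        rw [map_sub, map_sub, map_sub, map_sub] at hc
        rw [map_sub, map_sub, map_add, map_add, map_add, hl, hl, hl, MvPowerSeries.coeff_map,
          MvPowerSeries.coeff_map, MvPowerSeries.coeff_map, map_sub, map_sub]
        simp only [Subring.subtype_apply, AddSubgroupClass.coe_sub]
        linear_combination hc
      rw [sum_congr rfl hs] at h
      rw [← h]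
      linear_combination 2 * hlt
    refine ⟨fun i => -(g i - g₀ i - g₁ i).coeff d, mul_left_cancel₀ (two_ne_zero (α := BPQ)) ?_⟩
    rw [← neg_inj, key, mul_sum, ← sum_neg_distrib]
    refine sum_congr rfl fun i _ => ?_
    rw [Subring.coe_neg]
    ring

end BPNorm

/-! ### Formal sums: naturality, logarithms, and sums that are additive in low degrees -/

namespace FormalGroup

open Finset

variable {A B : Type*} [CommRing A] [CommRing B]

theorem hasSubst_pair {σ : Type*} {p q : MvPowerSeries σ A} (hp : p.constantCoeff = 0)
    (hq : q.constantCoeff = 0) : MvPowerSeries.HasSubst ![p, q] :=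
  MvPowerSeries.hasSubst_of_constantCoeff_zero fun s => by fin_cases s <;> simpa

theorem constantCoeff_subst_pair (G : FormalGroup A) {p q : PowerSeries A}
    (hp : p.constantCoeff = 0) (hq : q.constantCoeff = 0) :
    PowerSeries.constantCoeff (G.toPowerSeries.subst ![p, q] : PowerSeries A) = 0 :=
  MvPowerSeries.constantCoeff_subst_eq_zero (hasSubst_pair hp hq)
    (fun s => by fin_cases s <;> simpa) G.zero_constantCoeff

theorem map_subst_pair (φ : A →+* B) (G : FormalGroup A) {p q : PowerSeries A}
    (hp : p.constantCoeff = 0) (hq : q.constantCoeff = 0) :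
    PowerSeries.map φ (G.toPowerSeries.subst ![p, q] : PowerSeries A) =
      (G.map φ).toPowerSeries.subst ![p.map φ, q.map φ] := by
  refine (MvPowerSeries.map_subst (hasSubst_pair hp hq) _).trans ?_
  congr 1
  ext1 i
  fin_cases i <;> rfl

theorem constantCoeff_partialSum (G : FormalGroup A) {a : ℕ → PowerSeries A}
    (ha : ∀ i, (a i).constantCoeff = 0) (m : ℕ) : (partialSum G a m).constantCoeff = 0 := by
  induction m with
  | zero => simp [partialSum]
  | succ m ih => exact constantCoeff_subst_pair G ih (ha m)

theorem constantCoeff_C_mul_X_pow (a : A) (i : ℕ) :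
    (PowerSeries.C a * PowerSeries.X ^ 2 ^ i).constantCoeff = 0 := by
  simp

theorem map_partialSum (φ : A →+* B) (G : FormalGroup A) {a : ℕ → PowerSeries A}
    (ha : ∀ i, (a i).constantCoeff = 0) (m : ℕ) :
    (partialSum G a m).map φ = partialSum (G.map φ) (fun i => (a i).map φ) m := by
  induction m with
  | zero => simp [partialSum]
  | succ m ih =>
    rw [partialSum, map_subst_pair φ G (constantCoeff_partialSum G ha m) (ha m), ih, partialSum]

theorem expansionPartial_eq_partialSum (G : FormalGroup A) (c : PowerSeries A) (m : ℕ) :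
    expansionPartial G c m = partialSum G
      (fun i => PowerSeries.C (expansionCoeff G c i) * PowerSeries.X ^ 2 ^ i) m := by
  induction m with
  | zero => rfl
  | succ m ih => rw [partialSum, ← ih]; rfl

theorem constantCoeff_expansionPartial (G : FormalGroup A) (c : PowerSeries A) (m : ℕ) :
    (expansionPartial G c m).constantCoeff = 0 := by
  rw [expansionPartial_eq_partialSum]
  exact constantCoeff_partialSum G (fun i => constantCoeff_C_mul_X_pow _ i) m

theorem map_expansionPartial (φ : A →+* B) (G : FormalGroup A) (c : PowerSeries A) (m : ℕ) :
    (expansionPartial G c m).map φ = expansionPartial (G.map φ) (c.map φ) m := by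
  induction m with
  | zero => simp [expansionPartial]
  | succ m ih =>
    rw [expansionPartial, map_subst_pair φ G (constantCoeff_expansionPartial G c m)
      (constantCoeff_C_mul_X_pow _ m), expansionPartial, ← ih]
    simp

theorem map_expansionCoeff (φ : A →+* B) (G : FormalGroup A) (c : PowerSeries A) (i : ℕ) :
    φ (expansionCoeff G c i) = expansionCoeff (G.map φ) (c.map φ) i := by
  rw [expansionCoeff, expansionCoeff, ← map_expansionPartial, map_sub, PowerSeries.coeff_map,
    PowerSeries.coeff_map]

theorem map_twoSeries (φ : A →+* B) (G : FormalGroup A) :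
    G.twoSeries.map φ = (G.map φ).twoSeries := by
  rw [twoSeries, map_subst_pair φ G (by simp) (by simp), PowerSeries.map_X, twoSeries]

theorem constantCoeff_twoSeries (G : FormalGroup A) : G.twoSeries.constantCoeff = 0 :=
  constantCoeff_subst_pair G (by simp) (by simp)

theorem HasFormalSum.map (φ : A →+* B) {G : FormalGroup A} {a : ℕ → A} {c : PowerSeries A}
    (h : G.HasFormalSum (fun i => PowerSeries.C (a i) * PowerSeries.X ^ 2 ^ i) c) :
    (G.map φ).HasFormalSum (fun i => PowerSeries.C (φ (a i)) * PowerSeries.X ^ 2 ^ i)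
      (c.map φ) := by
  intro d
  filter_upwards [h d] with m hm
  have := map_partialSum φ G (fun i => constantCoeff_C_mul_X_pow (a i) i) m
  simp only [map_mul, PowerSeries.map_C, map_pow, PowerSeries.map_X] at this
  rw [← this, PowerSeries.coeff_map, hm, PowerSeries.coeff_map]

theorem HasFormalSum.of_map {φ : A →+* B} (hφ : Function.Injective φ) {G : FormalGroup A}
    {a : ℕ → A} {c : PowerSeries A}
    (h : (G.map φ).HasFormalSum (fun i => PowerSeries.C (φ (a i)) * PowerSeries.X ^ 2 ^ i)
      (c.map φ)) :
    G.HasFormalSum (fun i => PowerSeries.C (a i) * PowerSeries.X ^ 2 ^ i) c := by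
  intro d
  filter_upwards [h d] with m hm
  have := map_partialSum φ G (fun i => constantCoeff_C_mul_X_pow (a i) i) m
  simp only [map_mul, PowerSeries.map_C, map_pow, PowerSeries.map_X] at this
  rw [← this, PowerSeries.coeff_map, PowerSeries.coeff_map] at hm
  exact hφ hm

/-- `l (x) = x + ⋯` is a 2-typical logarithm of `G`. -/
structure IsTypicalLog (l : PowerSeries A) (G : FormalGroup A) : Prop where
  isTypical : l.IsTypical
  coeff_one : l.coeff 1 = 1
  subst_pair : ∀ p q : PowerSeries A, p.constantCoeff = 0 → q.constantCoeff = 0 →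
    l.subst (G.toPowerSeries.subst ![p, q] : PowerSeries A) = l.subst p + l.subst q

namespace IsTypicalLog

variable {l : PowerSeries A} {G : FormalGroup A}

theorem subst_twoSeries (h : IsTypicalLog l G) : l.subst G.twoSeries = l + l := by
  rw [twoSeries, h.subst_pair _ _ (by simp) (by simp), PowerSeries.X_subst]

theorem coeff_subst_expansionPartial (h : IsTypicalLog l G) (c : PowerSeries A) (m d : ℕ) :
    PowerSeries.coeff d (l.subst (expansionPartial G c m)) =
      ∑ j ∈ range m, PowerSeries.coeff d
        (l.subst (PowerSeries.C (expansionCoeff G c j) * PowerSeries.X ^ 2 ^ j)) := by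
  induction m with
  | zero =>
    rw [expansionPartial, PowerSeries.subst_zero_of_constantCoeff_zero
      h.isTypical.constantCoeff_eq_zero]
    simp
  | succ m ih =>
    rw [expansionPartial, h.subst_pair _ _ (constantCoeff_expansionPartial G c m)
      (constantCoeff_C_mul_X_pow _ m), map_add, ih, sum_range_succ]
    rfl

theorem coeff_subst_C_mul_X_pow (h : IsTypicalLog l G) (a : A) (j : ℕ) {d : ℕ}
    (hd : ∀ m, d ≠ 2 ^ m) :
    PowerSeries.coeff d (l.subst (PowerSeries.C a * PowerSeries.X ^ 2 ^ j : PowerSeries A)) =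
      0 := by
  by_cases hj : 2 ^ j ∣ d
  · obtain ⟨e, rfl⟩ := hj
    rw [PowerSeries.coeff_subst_C_mul_X_pow _ _ (by positivity), h.isTypical, zero_mul]
    rintro m rfl
    exact hd (j + m) (pow_add 2 j m).symm
  · exact PowerSeries.coeff_subst_C_mul_X_pow_of_not_dvd _ _ (by positivity) hj

variable {c : PowerSeries A}

/-- Each new summand of the expansion corrects the lowest coefficient in which the logarithms
differ. -/
theorem coeff_subst_expansionPartial_eq (h : IsTypicalLog l G) (hc : c.constantCoeff = 0)
    (hlc : PowerSeries.IsTypical (l.subst c)) (m : ℕ) : ∀ d < 2 ^ m,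
    PowerSeries.coeff d (l.subst (expansionPartial G c m)) = PowerSeries.coeff d (l.subst c) := by
  induction m with
  | zero =>
    intro d hd
    obtain rfl : d = 0 := by simpa using hd
    simp only [PowerSeries.coeff_zero_eq_constantCoeff_apply]
    rw [expansionPartial, PowerSeries.subst_zero_of_constantCoeff_zero
      h.isTypical.constantCoeff_eq_zero, hlc.constantCoeff_eq_zero, map_zero]
  | succ m ih =>
    intro d hd
    by_cases hpow : ∃ i, d = 2 ^ i
    · obtain ⟨i, rfl⟩ := hpow
      have hi : i < m + 1 := (Nat.pow_lt_pow_iff_right one_lt_two).mp hd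
      rw [h.coeff_subst_expansionPartial, sum_range_succ, ← h.coeff_subst_expansionPartial]
      rcases Nat.lt_succ_iff_lt_or_eq.mp hi with hi | rfl
      · rw [ih _ (Nat.pow_lt_pow_right one_lt_two hi),
          PowerSeries.coeff_subst_C_mul_X_pow_of_not_dvd _ _ (by positivity), _root_.add_zero]
        exact fun hdvd => absurd (Nat.le_of_dvd (by positivity) hdvd)
          (not_le.mpr (Nat.pow_lt_pow_right one_lt_two hi))
      · have h1 := PowerSeries.coeff_subst_C_mul_X_pow l (expansionCoeff G c i) (s := 2 ^ i)
          (by positivity) 1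
        have h2 := PowerSeries.coeff_subst_sub_coeff_subst l hc
          (constantCoeff_expansionPartial G c i) (N := 2 ^ i) fun d hd =>
            (PowerSeries.coeff_eq_of_coeff_subst_eq h.coeff_one
              (constantCoeff_expansionPartial G c i) hc ih d hd).symm
        rw [mul_one, pow_one, h.coeff_one, one_mul] at h1
        rw [h.coeff_one, one_mul] at h2
        rw [h1, expansionCoeff, ← h2]
        ring
    · push Not at hpow
      rw [hlc d hpow, h.coeff_subst_expansionPartial]
      exact sum_eq_zero fun j _ => h.coeff_subst_C_mul_X_pow _ _ hpow

/-- Over a ring with a 2-typical logarithm `l`, a series `c` has an expansion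
`∑^G c_i x ^ (2 ^ i)` if `l (c)` is 2-typical. -/
theorem hasFormalSum (h : IsTypicalLog l G) (hc : c.constantCoeff = 0)
    (hlc : PowerSeries.IsTypical (l.subst c)) :
    G.HasFormalSum
      (fun i => PowerSeries.C (expansionCoeff G c i) * PowerSeries.X ^ 2 ^ i) c := by
  intro d
  filter_upwards [Filter.eventually_ge_atTop d] with m hm
  rw [← expansionPartial_eq_partialSum]
  exact PowerSeries.coeff_eq_of_coeff_subst_eq h.coeff_one (constantCoeff_expansionPartial G c m) hc
    (h.coeff_subst_expansionPartial_eq hc hlc m) d (hm.trans_lt Nat.lt_two_pow_self)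

theorem coeff_subst_eq_sum (h : IsTypicalLog l G) (hc : c.constantCoeff = 0)
    (hlc : PowerSeries.IsTypical (l.subst c)) (m : ℕ) : PowerSeries.coeff (2 ^ m) (l.subst c) =
      ∑ j ∈ range (m + 1), l.coeff (2 ^ (m - j)) * expansionCoeff G c j ^ 2 ^ (m - j) := by
  rw [← h.coeff_subst_expansionPartial_eq hc hlc (m + 1) _
    (Nat.pow_lt_pow_right one_lt_two m.lt_succ_self), h.coeff_subst_expansionPartial]
  refine sum_congr rfl fun j hj => ?_
  have hj := mem_range.mp hj
  rw [← PowerSeries.coeff_subst_C_mul_X_pow _ _ (s := 2 ^ j) (by positivity), ← pow_add,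
    show j + (m - j) = m by omega]

end IsTypicalLog

/-- Coefficients of `G (p, q) - G (p, q')`, if only the linear term of `G` contributes. -/
theorem coeff_subst_pair_sub (G : FormalGroup A) {p q q' : PowerSeries A}
    (hp : p.constantCoeff = 0) (hq : q.constantCoeff = 0) (hq' : q'.constantCoeff = 0) {N : ℕ}
    (h : ∀ e : Fin 2 →₀ ℕ, e ≠ Finsupp.single 1 1 → G.toPowerSeries.coeff e *
      PowerSeries.coeff N (p ^ e 0 * (q ^ e 1 - q' ^ e 1)) = 0) :
    PowerSeries.coeff N (G.toPowerSeries.subst ![p, q] : PowerSeries A) -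
      PowerSeries.coeff N (G.toPowerSeries.subst ![p, q'] : PowerSeries A) =
      q.coeff N - q'.coeff N := by
  have h1 := hasSubst_pair hp hq
  have h2 := hasSubst_pair hp hq'
  have hprod : ∀ (r : PowerSeries A) (e : Fin 2 →₀ ℕ),
      (e.prod fun s n => (![p, r] s : MvPowerSeries Unit A) ^ n) = p ^ e 0 * r ^ e 1 := by
    intro r e
    rw [Finsupp.prod_fintype _ _ fun _ => pow_zero _, Fin.prod_univ_two]
    rfl
  rw [PowerSeries.coeff, MvPowerSeries.coeff_subst h1, MvPowerSeries.coeff_subst h2,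
    ← finsum_sub_distrib (MvPowerSeries.coeff_subst_finite h1 _ _)
      (MvPowerSeries.coeff_subst_finite h2 _ _)]
  simp only [hprod, smul_eq_mul]
  rw [finsum_eq_single _ (Finsupp.single 1 1)]
  · rw [G.lin_coeff_Y]
    simp
  · intro e he
    rw [← h e he, ← mul_sub, mul_sub (p ^ e 0), map_sub]
    rfl

/-- The formal group law `G` is `x + y` up to terms of total degree at least `N`. -/
def IsAdditiveBelow (G : FormalGroup A) (N : ℕ) : Prop :=
  ∀ e : Fin 2 →₀ ℕ, 2 ≤ e.degree → e.degree < N → G.toPowerSeries.coeff e = 0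

/-- If `G` is additive below degree `N` and `q` has order at least `r`, then `G (p, q)` is `p + q`
below degree `N + r - 1`. -/
theorem IsAdditiveBelow.coeff_subst_pair {G : FormalGroup A} {N : ℕ} (hG : G.IsAdditiveBelow N)
    {p q : PowerSeries A} (hp : p.constantCoeff = 0) {r : ℕ} (hr : 1 ≤ r) (hq : r ≤ q.order)
    {d : ℕ} (hd : d + 1 < N + r) :
    PowerSeries.coeff d (G.toPowerSeries.subst ![p, q] : PowerSeries A) =
      p.coeff d + q.coeff d := by
  have hq0 : q.constantCoeff = 0 := by
    rw [← PowerSeries.coeff_zero_eq_constantCoeff_apply]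
    exact PowerSeries.coeff_of_lt_order _ (lt_of_lt_of_le (by exact_mod_cast hr) hq)
  have h := coeff_subst_pair_sub G hp hq0 (map_zero _) (N := d) fun e he => ?_
  · rw [G.add_zero (.of_constantCoeff_zero' hp), map_zero, sub_zero] at h
    rw [← h]
    ring
  · have hdeg : e.degree = e 0 + e 1 := by rw [Finsupp.degree_eq_sum, Fin.sum_univ_two]
    rcases Nat.eq_zero_or_pos (e 1) with h1 | h1
    · simp [h1]
    · rcases Nat.lt_or_ge e.degree N with hN | hN
      · rw [hG e ?_ hN, zero_mul]
        by_contra hlt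
        refine he (Finsupp.ext fun i => ?_)
        fin_cases i <;> simp <;> omega
      · rw [zero_pow h1.ne', sub_zero, PowerSeries.coeff_of_lt_order, mul_zero]
        have ho : ((e 0 + e 1 * r : ℕ) : ℕ∞) ≤ (p ^ e 0 * q ^ e 1).order := by
          refine le_trans ?_ (PowerSeries.le_order_mul _ _)
          rw [Nat.cast_add, Nat.cast_mul]
          refine add_le_add (PowerSeries.le_order_pow_of_constantCoeff_eq_zero _ hp) ?_
          refine le_trans ?_ (PowerSeries.le_order_pow _ _)
          rw [nsmul_eq_mul]
          gcongr
        refine lt_of_lt_of_le ?_ ho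
        have : e 1 + r ≤ e 1 * r + 1 := by
          obtain ⟨b, hb⟩ : ∃ b, e 1 = b + 1 := ⟨e 1 - 1, by omega⟩
          obtain ⟨s, rfl⟩ : ∃ s, r = s + 1 := ⟨r - 1, by omega⟩
          rw [hb]; nlinarith [Nat.zero_le (b * s)]
        exact_mod_cast (by omega : d < e 0 + e 1 * r)

/-- A change of `q` in degree `N` changes `G (p, q)` by the same amount in degree `N`. -/
theorem coeff_subst_pair_sub_of_agree (G : FormalGroup A) {p q q' : PowerSeries A}
    (hp : p.constantCoeff = 0) (hq : q.constantCoeff = 0) (hq' : q'.constantCoeff = 0) {N : ℕ}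
    (h : ∀ d < N, q.coeff d = q'.coeff d) :
    PowerSeries.coeff N (G.toPowerSeries.subst ![p, q] : PowerSeries A) -
      PowerSeries.coeff N (G.toPowerSeries.subst ![p, q'] : PowerSeries A) =
      q.coeff N - q'.coeff N := by
  refine coeff_subst_pair_sub G hp hq hq' fun e he => ?_
  have hord : (N : ℕ∞) ≤ MvPowerSeries.order (q - q') := by
    rw [← PowerSeries.order_eq_order]
    exact PowerSeries.nat_le_order _ _ fun i hi => by rw [map_sub, h i hi, sub_self]
  rcases h1 : e 1 with _ | b
  · simp
  · have ho : ((e 0 + (N + b) : ℕ) : ℕ∞) ≤ (p ^ e 0 * (q ^ (b + 1) - q' ^ (b + 1))).order := by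
      refine le_trans ?_ (PowerSeries.le_order_mul _ _)
      rw [Nat.cast_add]
      refine add_le_add (PowerSeries.le_order_pow_of_constantCoeff_eq_zero _ hp) ?_
      rw [PowerSeries.order_eq_order]
      exact MvPowerSeries.le_order_pow_sub_pow hq hq' hord b
    rw [PowerSeries.coeff_of_lt_order _ (lt_of_lt_of_le _ ho), mul_zero]
    have : e 0 + b ≠ 0 := fun h0 => he (Finsupp.ext fun i => by
      fin_cases i <;> simp <;> omega)
    exact_mod_cast (by omega : N < e 0 + (N + b))

/-- If `G` is additive below degree `2 ^ k`, then a formal sum `∑^G a_i x ^ (2 ^ i)` is the ordinary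
sum up to and including degree `2 ^ k`: the summands with `i ≥ 1` are divisible by `x ^ 2`, so that
the lowest mixed term does not reach degree `2 ^ k`. -/
theorem HasFormalSum.coeff_eq_sum {G : FormalGroup A} {k : ℕ} (hG : G.IsAdditiveBelow (2 ^ k))
    {a : ℕ → A} {c : PowerSeries A}
    (h : G.HasFormalSum (fun i => PowerSeries.C (a i) * PowerSeries.X ^ 2 ^ i) c)
    {d : ℕ} (hd : d ≤ 2 ^ k) :
    c.coeff d = ∑ i ∈ range (k + 1), if d = 2 ^ i then a i else 0 := by
  have hpart : ∀ m, (partialSum G (fun i => PowerSeries.C (a i) * PowerSeries.X ^ 2 ^ i)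
      (m + 1)).coeff d = ∑ i ∈ range (m + 1), if d = 2 ^ i then a i else 0 := by
    intro m
    have hcoeff : ∀ i, (PowerSeries.C (a i) * PowerSeries.X ^ 2 ^ i).coeff d =
        if d = 2 ^ i then a i else 0 := fun i => by
      rw [PowerSeries.coeff_C_mul, PowerSeries.coeff_X_pow, mul_ite, mul_one, mul_zero]
    induction m with
    | zero =>
      rw [partialSum, partialSum, G.zero_add (.of_constantCoeff_zero'
        (constantCoeff_C_mul_X_pow _ _)), hcoeff, sum_range_one]
    | succ m ih =>
      rw [partialSum, hG.coeff_subst_pair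
        (constantCoeff_partialSum G (fun i => constantCoeff_C_mul_X_pow _ i) _) one_le_two
        (r := 2) ?_ (by omega), ih, sum_range_succ _ (m + 1), hcoeff]
      refine PowerSeries.nat_le_order _ _ fun i hi => ?_
      rw [PowerSeries.coeff_C_mul, PowerSeries.coeff_X_pow, if_neg, mul_zero]
      have := Nat.pow_le_pow_right two_pos (show 1 ≤ m + 1 by omega)
      omega
  obtain ⟨m, hm, hkm⟩ := ((h d).and (Filter.eventually_ge_atTop (k + 1))).exists
  obtain ⟨m, rfl⟩ : ∃ m', m = m' + 1 := ⟨m - 1, by omega⟩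
  rw [← hm, hpart]
  refine (sum_subset (range_subset_range.mpr hkm) fun i _ hi => if_neg ?_).symm
  have hi : k + 1 ≤ i := by simpa using hi
  have := Nat.pow_lt_pow_right one_lt_two (show k < i by omega)
  omega

theorem HasFormalSum.coeff_two_pow {G : FormalGroup A} {k : ℕ} (hG : G.IsAdditiveBelow (2 ^ k))
    {a : ℕ → A} {c : PowerSeries A}
    (h : G.HasFormalSum (fun i => PowerSeries.C (a i) * PowerSeries.X ^ 2 ^ i) c)
    {i : ℕ} (hi : i ≤ k) : c.coeff (2 ^ i) = a i := by
  rw [h.coeff_eq_sum hG (Nat.pow_le_pow_right two_pos hi), sum_eq_single i]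
  · rw [if_pos rfl]
  · intro j _ hj
    exact if_neg fun h => hj (Nat.pow_right_injective le_rfl h).symm
  · exact fun h => absurd (mem_range.mpr (by omega)) h

end FormalGroup

/-! ### The expansions over `ℛ_n` -/

namespace BPNorm

open Finset FormalGroup

theorem isTypicalLog_fglQ (n i : ℕ) :
    IsTypicalLog (logBP.map (unitQ n i : BPQ →+* NormQ n)) (fglQ n i) where
  isTypical := logBP_isTypical.map _
  coeff_one := coeff_one_map_eq_one logBP_one _
  subst_pair p q hp hq := by
    have hl0 := constantCoeff_map_eq_zero logBP_zero (unitQ n i : BPQ →+* NormQ n)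
    rw [fglQ_eq, subst_logSum _ _ hl0 hp hq]
    refine subst_subst_cancel (constantCoeff_map_eq_zero expBP_zero _) (log_exp_map n i) ?_
    rw [map_add, PowerSeries.constantCoeff_subst_eq_zero hp _ hl0,
      PowerSeries.constantCoeff_subst_eq_zero hq _ hl0, _root_.add_zero]

theorem log_subst_psiQ (n i j : ℕ) :
    (logBP.map (unitQ n j : BPQ →+* NormQ n)).subst (psiQ n i j).toPowerSeries =
      logBP.map (unitQ n i : BPQ →+* NormQ n) :=
  subst_subst_cancel (constantCoeff_map_eq_zero expBP_zero _) (log_exp_map n j)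
    (constantCoeff_map_eq_zero logBP_zero _)

/-- The canonical strict isomorphisms compose; it suffices to compare logarithms. -/
theorem psiQ_subst_psiQ (n i j k : ℕ) :
    (psiQ n j k).toPowerSeries.subst (psiQ n i j).toPowerSeries = (psiQ n i k).toPowerSeries := by
  refine PowerSeries.eq_of_subst_eq (coeff_one_map_eq_one logBP_one (unitQ n k : BPQ →+* NormQ n))
    (PowerSeries.constantCoeff_subst_eq_zero (psiQ n i j).constantCoeff_eq _
      (psiQ n j k).constantCoeff_eq) (psiQ n i k).constantCoeff_eq ?_
  rw [← PowerSeries.subst_comp_subst_apply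
    (.of_constantCoeff_zero' (psiQ n j k).constantCoeff_eq)
    (.of_constantCoeff_zero' (psiQ n i j).constantCoeff_eq), log_subst_psiQ, log_subst_psiQ,
    log_subst_psiQ]

theorem twoSeries_subst_psiQ (n i j : ℕ) :
    (fglQ n j).twoSeries.subst (psiQ n i j).toPowerSeries =
      (psiQ n i j).toPowerSeries.subst (fglQ n i).twoSeries := by
  have h0 := (psiQ n i j).constantCoeff_eq
  have hs := PowerSeries.HasSubst.of_constantCoeff_zero' h0
  refine PowerSeries.eq_of_subst_eq (coeff_one_map_eq_one logBP_one (unitQ n j : BPQ →+* NormQ n))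
    (PowerSeries.constantCoeff_subst_eq_zero h0 _ (constantCoeff_twoSeries _))
    (PowerSeries.constantCoeff_subst_eq_zero (constantCoeff_twoSeries _) _ h0) ?_
  rw [← PowerSeries.subst_comp_subst_apply (.of_constantCoeff_zero' (constantCoeff_twoSeries _)) hs,
    ← PowerSeries.subst_comp_subst_apply hs (.of_constantCoeff_zero' (constantCoeff_twoSeries _)),
    (isTypicalLog_fglQ n j).subst_twoSeries, PowerSeries.subst_add hs, log_subst_psiQ,
    (isTypicalLog_fglQ n i).subst_twoSeries]

theorem map_psiQ {r n : ℕ} (φ : NormQ r →ₐ[ℚ] NormQ n) {i j i' j' : ℕ}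
    (hi : φ.comp (unitQ r i) = unitQ n i') (hj : φ.comp (unitQ r j) = unitQ n j') :
    (psiQ r i j).toPowerSeries.map (φ : NormQ r →+* NormQ n) = (psiQ n i' j').toPowerSeries := by
  have hmap {i i' : ℕ} (h : φ.comp (unitQ r i) = unitQ n i') (p : PowerSeries BPQ) :
      PowerSeries.map (φ : NormQ r →+* NormQ n)
        (p.map (unitQ r i : BPQ →+* NormQ r)) = p.map (unitQ n i' : BPQ →+* NormQ n) := by
    rw [← h, ← RingHom.comp_apply, ← PowerSeries.map_comp]; rfl
  refine Eq.trans (PowerSeries.map_subst (.of_constantCoeff_zero'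
    (constantCoeff_map_eq_zero logBP_zero (unitQ r i : BPQ →+* NormQ r)))
    (h := (φ : NormQ r →+* NormQ n)) (expBP.map (unitQ r j : BPQ →+* NormQ r))) ?_
  exact congrArg₂ (fun a b => PowerSeries.subst a b) (hmap hi logBP) (hmap hj expBP)

theorem map_fglQ {r n : ℕ} (φ : NormQ r →ₐ[ℚ] NormQ n) {i i' : ℕ}
    (hi : φ.comp (unitQ r i) = unitQ n i') :
    (fglQ r i).map (φ : NormQ r →+* NormQ n) = fglQ n i' := by
  ext d
  simp only [fglQ, FormalGroup.map_toPowerSeries, MvPowerSeries.coeff_map, ← hi]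
  rfl

theorem formalGroup_ext_of_map {n : ℕ} {G G' : FormalGroup (R n)}
    (h : G.map (R n).subtype = G'.map (R n).subtype) : G = G' := by
  refine FormalGroup.ext (MvPowerSeries.ext fun d => Subtype.ext ?_)
  exact congrArg (MvPowerSeries.coeff d) (congrArg FormalGroup.toPowerSeries h)

theorem powerSeries_ext_of_map {n : ℕ} {f g : PowerSeries (R n)}
    (h : f.map (R n).subtype = g.map (R n).subtype) : f = g :=
  PowerSeries.map_injective _ Subtype.val_injective h

theorem psi_map_subtype (n : ℕ) :
    (psi n).toPowerSeries.map (R n).subtype = (psiQ n 0 1).toPowerSeries :=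
  PowerSeries.map_toSubring _ _ _

theorem F_twoSeries_map_subtype (n : ℕ) :
    (F n).twoSeries.map (R n).subtype = (fglQ n 0).twoSeries := by
  rw [map_twoSeries, F_map_subtype]

theorem t_coe (n k : ℕ) : (R n).subtype (t n k) =
    expansionCoeff (fglQ n 1) (psiQ n 0 1).toPowerSeries k := by
  rw [t, map_expansionCoeff, F_map_gamma_map_subtype, psi_map_subtype]

theorem v_coe (n k : ℕ) : (R n).subtype (v n k) =
    expansionCoeff (fglQ n 0) (fglQ n 0).twoSeries k := by
  rw [v, map_expansionCoeff, F_map_subtype, F_twoSeries_map_subtype]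

theorem t_zero (n : ℕ) : t n 0 = 1 := by
  rw [t, expansionCoeff, expansionPartial, pow_zero, (psi n).coeff_one_eq, map_zero, sub_zero]

/-- The expansion of `ψ_γ` exists because the logarithm of `ℱ^γ` carries `ψ_γ` to the logarithm of
`ℱ`, which is 2-typical. -/
theorem hasFormalSum_psi (n : ℕ) : ((F n).map (gamma n)).HasFormalSum
    (fun k => PowerSeries.C (t n k) * PowerSeries.X ^ 2 ^ k) (psi n).toPowerSeries := by
  refine HasFormalSum.of_map (φ := (R n).subtype) Subtype.val_injective ?_
  simp only [t_coe]
  rw [F_map_gamma_map_subtype, psi_map_subtype]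
  refine (isTypicalLog_fglQ n 1).hasFormalSum (psiQ n 0 1).constantCoeff_eq ?_
  rw [log_subst_psiQ]
  exact (isTypicalLog_fglQ n 0).isTypical

theorem isTypical_log_subst_twoSeries (n : ℕ) : PowerSeries.IsTypical
    ((logBP.map (unitQ n 0 : BPQ →+* NormQ n)).subst (fglQ n 0).twoSeries) := by
  rw [(isTypicalLog_fglQ n 0).subst_twoSeries]
  intro d hd
  rw [map_add, (isTypicalLog_fglQ n 0).isTypical d hd, _root_.add_zero]

theorem hasFormalSum_twoSeries (n : ℕ) : (F n).HasFormalSum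
    (fun k => PowerSeries.C (v n k) * PowerSeries.X ^ 2 ^ k) (F n).twoSeries := by
  refine HasFormalSum.of_map (φ := (R n).subtype) Subtype.val_injective ?_
  simp only [v_coe]
  rw [F_map_subtype, F_twoSeries_map_subtype]
  exact (isTypicalLog_fglQ n 0).hasFormalSum (constantCoeff_twoSeries _)
    (isTypical_log_subst_twoSeries n)

/-! ### Integrality and the ideals `I_k` -/

/-- The recursion of Araki: `2 ℓ_m = ∑_{0 ≤ i ≤ m} ℓ_i v_{m-i} ^ (2 ^ i)`. -/
theorem two_mul_unitQ_ell (n m : ℕ) : 2 * unitQ n 0 (ell m) =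
    ∑ i ∈ range (m + 1), unitQ n 0 (ell i) * (v n (m - i) : NormQ n) ^ 2 ^ i := by
  have h := (isTypicalLog_fglQ n 0).coeff_subst_eq_sum (constantCoeff_twoSeries _)
    (isTypical_log_subst_twoSeries n) m
  rw [(isTypicalLog_fglQ n 0).subst_twoSeries, ← sum_range_reflect, map_add,
    PowerSeries.coeff_map, coeff_logBP, ← two_mul] at h
  refine h.trans (sum_congr rfl fun i hi => ?_)
  have hi := mem_range.mp hi
  rw [show m - (m + 1 - 1 - i) = i by omega, show m + 1 - 1 - i = m - i by omega,
    PowerSeries.coeff_map, coeff_logBP]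
  congr 2
  exact (v_coe n (m - i)).symm

theorem coe_two (n : ℕ) : ((2 : R n) : NormQ n) = 2 := rfl

theorem v_zero (n : ℕ) : v n 0 = 2 := by
  apply Subtype.val_injective
  have h := two_mul_unitQ_ell n 0
  rw [sum_range_one, show ell 0 = 1 from rfl, map_one, mul_one, one_mul, pow_zero, pow_one] at h
  exact h.symm

theorem C_inv_mem_R (n N : ℕ) : MvPolynomial.C ((1 - 2 ^ (N + 1) : ℚ)⁻¹) ∈ R n := by
  refine Subring.subset_closure (.inl ⟨_, ?_, rfl⟩)
  have h : (1 - 2 ^ (N + 1) : ℚ) = ((1 - 2 ^ (N + 1) : ℤ) : ℚ) := by push_cast; rfl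
  have hodd : Odd (1 - 2 ^ (N + 1) : ℤ) := by
    rw [pow_succ']
    exact ⟨-2 ^ N, by ring⟩
  have hne : (1 - 2 ^ (N + 1) : ℤ) ≠ 0 := fun h0 => by simp [h0] at hodd
  rw [h, Rat.inv_intCast_den, if_neg hne]
  exact Int.natAbs_odd.mpr hodd

/-- The denominator of `ℓ_m` divides `2 ^ m`. -/
theorem two_pow_mul_unitQ_ell_mem (n m : ℕ) : 2 ^ m * unitQ n 0 (ell m) ∈ R n := by
  induction m using Nat.strong_induction_on with
  | _ m ih =>
    rcases m with _ | m
    · simp [show ell 0 = 1 from rfl, one_mem]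
    -- The recursion determines `(2 - 2 ^ (N + 2)) ℓ_{m+1}`, and `1 - 2 ^ (N + 1)` is odd.
    obtain ⟨N, hN⟩ : ∃ N, 2 ^ (m + 1) = N + 2 := by
      have := Nat.pow_le_pow_right two_pos (show 1 ≤ m + 1 by omega)
      exact ⟨2 ^ (m + 1) - 2, by omega⟩
    have h := two_mul_unitQ_ell n (m + 1)
    rw [sum_range_succ, Nat.sub_self, v_zero, coe_two, hN] at h
    have hmem : (1 - 2 ^ (N + 1)) * (2 ^ (m + 1) * unitQ n 0 (ell (m + 1))) ∈ R n := by
      have : (1 - 2 ^ (N + 1)) * (2 ^ (m + 1) * unitQ n 0 (ell (m + 1))) =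
          ∑ i ∈ range (m + 1), 2 ^ (m - i) * (2 ^ i * unitQ n 0 (ell i)) *
            (v n (m + 1 - i) : NormQ n) ^ 2 ^ i := by
        have hs : ∑ i ∈ range (m + 1), 2 ^ (m - i) * (2 ^ i * unitQ n 0 (ell i)) *
            (v n (m + 1 - i) : NormQ n) ^ 2 ^ i = 2 ^ m * ∑ i ∈ range (m + 1),
            unitQ n 0 (ell i) * (v n (m + 1 - i) : NormQ n) ^ 2 ^ i := by
          rw [mul_sum]
          refine sum_congr rfl fun i hi => ?_
          have hi := mem_range.mp hi
          rw [← mul_assoc (2 ^ (m - i)), ← pow_add, show m - i + i = m by omega, mul_assoc]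
        rw [hs]
        linear_combination 2 ^ m * h
      rw [this]
      exact sum_mem fun i hi => mul_mem (mul_mem (pow_mem (ofNat_mem _ 2) _)
        (ih i (mem_range.mp hi))) (pow_mem (v n _).2 _)
    have hC : (MvPolynomial.C ((1 - 2 ^ (N + 1) : ℚ)⁻¹) : NormQ n) * (1 - 2 ^ (N + 1)) = 1 := by
      have h2 : (1 - 2 ^ (N + 1) : NormQ n) = MvPolynomial.C (1 - 2 ^ (N + 1) : ℚ) := by
        rw [map_sub, map_one, map_pow, map_ofNat]
      rw [h2, ← map_mul, inv_mul_cancel₀, map_one]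
      exact sub_ne_zero.mpr (one_lt_pow₀ one_lt_two N.succ_ne_zero).ne
    have := mul_mem (C_inv_mem_R n N) hmem
    rwa [← mul_assoc, hC, one_mul] at this

/-- The generators of Hazewinkel and of Araki agree modulo `2`. -/
theorem exists_unitQ_hazewinkel (n m : ℕ) : ∃ s : R n,
    unitQ n 0 (hazewinkel (m + 1)) = ((v n (m + 1) + 2 * s : R n) : NormQ n) := by
  induction m using Nat.strong_induction_on with
  | _ m ih =>
    have hH := congrArg (unitQ n 0) (two_mul_ell m)
    have hA := two_mul_unitQ_ell n (m + 1)
    rw [map_mul, map_ofNat, map_sum, hA, sum_range_succ, sum_range_succ', sum_range_succ',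
      Nat.sub_self, v_zero, coe_two] at hH
    -- Congruence modulo `2` becomes congruence modulo `2 ^ (i + 2)` for the powers, which absorbs
    -- the denominator of `ℓ_{i+1}`.
    have hterm : ∀ i ∈ range m, ∃ r : R n, unitQ n 0 (ell (i + 1)) *
        ((v n (m + 1 - (i + 1)) : NormQ n) ^ 2 ^ (i + 1)) - unitQ n 0 (ell (i + 1) *
          hazewinkel (m + 1 - (i + 1)) ^ 2 ^ (i + 1)) = ((2 * r : R n) : NormQ n) := by
      intro i hi
      have hi := mem_range.mp hi
      obtain ⟨j, hj⟩ : ∃ j, m + 1 - (i + 1) = j + 1 := ⟨m - i - 1, by omega⟩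
      obtain ⟨s, hs⟩ := ih j (by omega)
      obtain ⟨q, hq⟩ := dvd_sub_pow_of_dvd_sub (p := 2) (a := v n (j + 1))
        (b := v n (j + 1) + 2 * s) ⟨-s, by push_cast; ring⟩ (i + 1)
      refine ⟨⟨_, two_pow_mul_unitQ_ell_mem n (i + 1)⟩ * q, ?_⟩
      rw [Nat.cast_ofNat] at hq
      have hq' := congrArg (R n).subtype hq
      rw [map_sub, map_pow, map_mul, map_pow, map_pow, map_ofNat] at hq'
      rw [hj, map_mul, map_pow, hs, ← mul_sub]
      refine (congrArg _ hq').trans ?_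
      simp only [Subring.coe_mul, Subring.subtype_apply, coe_two]
      ring
    choose! r hr using hterm
    obtain ⟨N, hN⟩ : ∃ N, 2 ^ (m + 1) = N + 1 + (m + 1) := by
      have := Nat.lt_two_pow_self (n := m + 1)
      exact ⟨2 ^ (m + 1) - (m + 2), by omega⟩
    refine ⟨2 ^ N * ⟨_, two_pow_mul_unitQ_ell_mem n (m + 1)⟩ + ∑ i ∈ range m, r i, ?_⟩
    have hsum := sum_congr rfl hr
    rw [sum_sub_distrib] at hsum
    simp only [show ell 0 = 1 from rfl, map_one, pow_zero, pow_one, one_mul, Nat.sub_zero] at hH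
    rw [hN] at hH
    push_cast at hsum hH ⊢
    simp only [coe_two] at hsum ⊢
    rw [← mul_sum] at hsum
    linear_combination hsum - hH

theorem v_mem_I (n : ℕ) {i k : ℕ} (hi : i < k) : v n i ∈ I n k := by
  rcases Nat.eq_zero_or_pos i with rfl | h
  · rw [v_zero]
    exact Ideal.subset_span (.inl rfl)
  · exact Ideal.subset_span (.inr ⟨i, h, hi, rfl⟩)

theorem two_mem_I (n k : ℕ) : 2 ∈ I n k := Ideal.subset_span (.inl rfl)

theorem I_mono (n : ℕ) {i k : ℕ} (h : i ≤ k) : I n i ≤ I n k := by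
  refine Ideal.span_le.mpr ?_
  rintro a (rfl | ⟨j, hj, hji, rfl⟩)
  · exact two_mem_I n k
  · exact v_mem_I n (hji.trans_le h)

theorem unitQ_mem_R (n : ℕ) {a : BPQ} (ha : a ∈ hazewinkelRing) : unitQ n 0 a ∈ R n := by
  suffices hazewinkelRing ≤ (R n).comap (unitQ n 0 : BPQ →+* NormQ n) from this ha
  refine Subring.closure_le.mpr ?_
  rintro _ ⟨m, rfl⟩
  obtain ⟨s, hs⟩ := exists_unitQ_hazewinkel n m
  exact Subring.mem_comap.mpr (hs ▸ SetLike.coe_mem _)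

/-- Modulo `I_k`, the formal group law `ℱ` is additive below degree `2 ^ k`. -/
theorem coeff_F_mem_I (n k : ℕ) {e : Fin 2 →₀ ℕ} (h2 : 2 ≤ e.degree) (hk : e.degree < 2 ^ k) :
    (F n).toPowerSeries.coeff e ∈ I n k := by
  obtain ⟨M, rfl⟩ : ∃ M, k = M + 1 := ⟨k - 1, by rcases k with _ | k <;> simp at hk ⊢; omega⟩
  obtain ⟨a, ha⟩ := exists_coeff_fglBP M h2 hk
  choose s hs using exists_unitQ_hazewinkel n
  have : (F n).toPowerSeries.coeff e =
      ∑ i ∈ range M, (v n (i + 1) + 2 * s i) * ⟨_, unitQ_mem_R n (a i).2⟩ := by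
    apply Subtype.val_injective
    change unitQ n 0 (fglBP.toPowerSeries.coeff e) = _
    rw [ha, map_sum]
    push_cast
    refine sum_congr rfl fun i _ => ?_
    rw [map_mul, hs]
    push_cast
    rfl
  rw [this]
  refine sum_mem fun i hi => Ideal.mul_mem_right _ _ (add_mem (v_mem_I n ?_)
    (Ideal.mul_mem_right _ _ (two_mem_I n _)))
  have := mem_range.mp hi
  omega

theorem isAdditiveBelow_F (n k : ℕ) :
    ((F n).map (Ideal.Quotient.mk (I n k))).IsAdditiveBelow (2 ^ k) := fun e h2 hk => by
  rw [FormalGroup.map_toPowerSeries, MvPowerSeries.coeff_map]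
  exact Ideal.Quotient.eq_zero_iff_mem.mpr (coeff_F_mem_I n k h2 hk)

theorem coeff_twoSeries_mem_I (n k : ℕ) {d : ℕ} (hd : d < 2 ^ k) :
    (F n).twoSeries.coeff d ∈ I n k := by
  rw [← Ideal.Quotient.eq_zero_iff_mem, ← PowerSeries.coeff_map,
    ((hasFormalSum_twoSeries n).map _).coeff_eq_sum (isAdditiveBelow_F n k) hd.le]
  refine sum_eq_zero fun i _ => ?_
  split_ifs with h
  · refine Ideal.Quotient.eq_zero_iff_mem.mpr (v_mem_I n ?_)
    exact (Nat.pow_lt_pow_iff_right one_lt_two).mp (h ▸ hd)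
  · rfl

/-- Modulo `I_k`, the generator `v_k` is the leading coefficient of the 2-series. -/
theorem mk_v (n k : ℕ) : Ideal.Quotient.mk (I n k) (v n k) =
    Ideal.Quotient.mk (I n k) ((F n).twoSeries.coeff (2 ^ k)) := by
  rw [← PowerSeries.coeff_map,
    ((hasFormalSum_twoSeries n).map _).coeff_two_pow (isAdditiveBelow_F n k) le_rfl]

theorem twoSeries_subst_psi (n : ℕ) :
    ((F n).map (gamma n)).twoSeries.subst (psi n).toPowerSeries =
      (psi n).toPowerSeries.subst (F n).twoSeries := by
  apply powerSeries_ext_of_map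
  refine ((PowerSeries.map_subst
    (.of_constantCoeff_zero' (psi n).constantCoeff_eq) _).trans ?_).trans
      (PowerSeries.map_subst (.of_constantCoeff_zero' (constantCoeff_twoSeries _)) _).symm
  change PowerSeries.subst (PowerSeries.map _ _) _ = PowerSeries.subst (PowerSeries.map _ _) _
  rw [map_twoSeries, F_map_gamma_map_subtype, psi_map_subtype, F_twoSeries_map_subtype]
  exact twoSeries_subst_psiQ n 0 1

/-- The 2-series of `ℱ^γ` is conjugate to that of `ℱ`, so its coefficients below degree `2 ^ k` lie
in the same ideal. -/
theorem gamma_coeff_twoSeries_mem_I (n k : ℕ) {d : ℕ} (hd : d < 2 ^ k) :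
    gamma n ((F n).twoSeries.coeff d) ∈ I n k := by
  let π := Ideal.Quotient.mk (I n k)
  set f := ((F n).map (gamma n)).twoSeries.map π with hf
  set p := (psi n).toPowerSeries.map π with hp
  have hp0 : p.constantCoeff = 0 := by
    rw [hp, ← PowerSeries.coeff_zero_eq_constantCoeff_apply, PowerSeries.coeff_map,
      PowerSeries.coeff_zero_eq_constantCoeff_apply, (psi n).constantCoeff_eq, map_zero]
  have hp1 : IsUnit (p.coeff 1) := by
    rw [hp, PowerSeries.coeff_map, (psi n).coeff_one_eq, map_one]
    exact isUnit_one
  have h1 : f.subst p = p.subst ((F n).twoSeries.map π) :=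
    (PowerSeries.map_subst (.of_constantCoeff_zero' (psi n).constantCoeff_eq) _).symm.trans
      ((congrArg (PowerSeries.map π) (twoSeries_subst_psi n)).trans
        (PowerSeries.map_subst (.of_constantCoeff_zero' (constantCoeff_twoSeries _)) _))
  have h2 : ((2 ^ k : ℕ) : ℕ∞) ≤ PowerSeries.order (f.subst p) := by
    rw [h1]
    refine le_trans (PowerSeries.nat_le_order _ _ fun i hi => ?_)
      (PowerSeries.le_order_subst_right' ?_ hp0)
    · rw [PowerSeries.coeff_map]
      exact Ideal.Quotient.eq_zero_iff_mem.mpr (coeff_twoSeries_mem_I n k hi)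
    · rw [map_twoSeries]
      exact constantCoeff_twoSeries _
  -- Composition with the inverse of `ψ` does not lower the order.
  have h3 : PowerSeries.subst (p.substInvOfIsUnit hp1) (f.subst p) = f := by
    rw [PowerSeries.subst_comp_subst_apply (.of_constantCoeff_zero' hp0)
      (.of_constantCoeff_zero' (by simp)), PowerSeries.subst_substInvOfIsUnit_right _ hp0,
      PowerSeries.X_subst]
  have h4 : ((2 ^ k : ℕ) : ℕ∞) ≤ f.order := by
    rw [← h3]
    exact h2.trans (PowerSeries.le_order_subst_left' (by simp))
  have h5 := PowerSeries.coeff_of_lt_order d (lt_of_lt_of_le (by exact_mod_cast hd) h4)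
  rw [hf, PowerSeries.coeff_map, ← map_twoSeries, PowerSeries.coeff_map] at h5
  exact Ideal.Quotient.eq_zero_iff_mem.mp h5

/-- The ideals `I_k` are invariant: modulo `I_i` the generator `v_i` is the coefficient of
`x ^ (2 ^ i)` in the 2-series, to which `gamma_coeff_twoSeries_mem_I` applies. -/
theorem gamma_mem_I (n k : ℕ) {a : R n} (ha : a ∈ I n k) : gamma n a ∈ I n k := by
  induction k using Nat.strong_induction_on generalizing a with
  | _ k ih =>
    suffices I n k ≤ (I n k).comap (gamma n) from this ha
    refine Ideal.span_le.mpr ?_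
    rintro a (rfl | ⟨i, -, hi, rfl⟩)
    · exact Ideal.mem_comap.mpr (by rw [map_ofNat]; exact two_mem_I n k)
    · have h1 := ih i hi (Ideal.Quotient.eq.mp (mk_v n i))
      have h2 := gamma_coeff_twoSeries_mem_I n k (Nat.pow_lt_pow_right one_lt_two hi)
      rw [map_sub] at h1
      exact Ideal.mem_comap.mpr (by simpa using add_mem (I_mono n hi.le h1) h2)

theorem isAdditiveBelow_map_gamma {n k : ℕ} {G : FormalGroup (R n)}
    (hG : (G.map (Ideal.Quotient.mk (I n k))).IsAdditiveBelow (2 ^ k)) :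
    ((G.map (gamma n)).map (Ideal.Quotient.mk (I n k))).IsAdditiveBelow (2 ^ k) :=
  fun e h2 hk => by
    have := hG e h2 hk
    simp only [FormalGroup.map_toPowerSeries, MvPowerSeries.coeff_map] at this ⊢
    exact Ideal.Quotient.eq_zero_iff_mem.mpr
      (gamma_mem_I n k (Ideal.Quotient.eq_zero_iff_mem.mp this))

end BPNorm

/-! ### The congruences -/

namespace BPNorm

open Finset FormalGroup

theorem constantCoeff_map_psi {A : Type*} [CommRing A] {n : ℕ} (φ : R n →+* A) :
    ((psi n).toPowerSeries.map φ).constantCoeff = 0 := by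
  rw [← PowerSeries.coeff_zero_eq_constantCoeff_apply, PowerSeries.coeff_map,
    PowerSeries.coeff_zero_eq_constantCoeff_apply, (psi n).constantCoeff_eq, map_zero]

theorem incl_F (r n : ℕ) (hr : 1 ≤ r) (hrn : r ≤ n) : (F r).map (incl r n hr hrn) = F n := by
  apply formalGroup_ext_of_map
  rw [F_map_subtype]
  exact map_fglQ (inclQ r n) (inclQ_comp_unitQ hr hrn 0)

theorem incl_v (r n : ℕ) (hr : 1 ≤ r) (hrn : r ≤ n) (k : ℕ) : incl r n hr hrn (v r k) = v n k := by
  rw [v, v, map_expansionCoeff, map_twoSeries, incl_F]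

theorem incl_mem_I (r n : ℕ) (hr : 1 ≤ r) (hrn : r ≤ n) (k : ℕ) {a : R r} (ha : a ∈ I r k) :
    incl r n hr hrn a ∈ I n k := by
  suffices I r k ≤ (I n k).comap (incl r n hr hrn) from this ha
  refine Ideal.span_le.mpr ?_
  rintro a (rfl | ⟨i, -, hi, rfl⟩)
  · exact Ideal.mem_comap.mpr (by rw [map_ofNat]; exact two_mem_I n k)
  · exact Ideal.mem_comap.mpr (by rw [incl_v]; exact v_mem_I n hi)

theorem inclQ_comp_unitQ_one {n : ℕ} (h1 : 1 ≤ n - 1) (h2 : n - 1 ≤ n) :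
    (inclQ (n - 1) n).comp (unitQ (n - 1) 1) = unitQ n 2 := by
  rw [inclQ_comp_unitQ h1 h2, show n - (n - 1) = 1 by omega, pow_one, mul_one]

theorem incl_map_gamma_F {n : ℕ} (h1 : 1 ≤ n - 1) (h2 : n - 1 ≤ n) :
    ((F (n - 1)).map (gamma (n - 1))).map (incl (n - 1) n h1 h2) =
      ((F n).map (gamma n)).map (gamma n) := by
  apply formalGroup_ext_of_map
  have hL := congrArg (fun G => FormalGroup.map G (inclQ (n - 1) n : NormQ (n - 1) →+* NormQ n))
    (F_map_gamma_map_subtype (n - 1))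
  have hR := congrArg (fun G => FormalGroup.map G (gammaQ n : NormQ n →+* NormQ n))
    (F_map_gamma_map_subtype n)
  refine Eq.trans hL (Eq.trans ?_ hR.symm)
  exact (map_fglQ (inclQ (n - 1) n) (inclQ_comp_unitQ_one h1 h2)).trans
    (map_fglQ (gammaQ n) (gammaQ_comp_unitQ n 1)).symm

theorem map_gamma_psi_map_subtype (n : ℕ) :
    ((psi n).toPowerSeries.map (gamma n)).map (R n).subtype = (psiQ n 1 2).toPowerSeries := by
  have h := congrArg (PowerSeries.map (gammaQ n : NormQ n →+* NormQ n)) (psi_map_subtype n)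
  rw [map_psiQ (gammaQ n) (gammaQ_comp_unitQ n 0) (gammaQ_comp_unitQ n 1)] at h
  exact h

/-- The isomorphism `ψ_{γ^2}` is the composite `ℱ → ℱ^γ → ℱ^(γ^2)`. -/
theorem incl_psi {n : ℕ} (h1 : 1 ≤ n - 1) (h2 : n - 1 ≤ n) :
    (psi (n - 1)).toPowerSeries.map (incl (n - 1) n h1 h2) =
      ((psi n).toPowerSeries.map (gamma n)).subst (psi n).toPowerSeries := by
  apply powerSeries_ext_of_map
  have h := congrArg (PowerSeries.map (inclQ (n - 1) n : NormQ (n - 1) →+* NormQ n))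
    (psi_map_subtype (n - 1))
  rw [map_psiQ (inclQ (n - 1) n) (inclQ_comp_unitQ h1 h2 0)
    (inclQ_comp_unitQ_one h1 h2), mul_zero] at h
  refine Eq.trans h (Eq.symm ?_)
  refine (PowerSeries.map_subst (.of_constantCoeff_zero' (psi n).constantCoeff_eq) _).trans ?_
  change PowerSeries.subst (PowerSeries.map _ _) _ = _
  rw [psi_map_subtype, map_gamma_psi_map_subtype, psiQ_subst_psiQ]

/-- Modulo `I_k` and up to degree `2 ^ k`, all three formal sums are ordinary sums, so the identity
is the comparison of the coefficients of `x ^ (2 ^ k)` in `ψ_{γ^2} = (γ ψ) ∘ ψ`, where `2 ^ j`-th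
powers are additive. -/
theorem incl_t_smodEq {n k : ℕ} (h1 : 1 ≤ n - 1) (h2 : n - 1 ≤ n) (hk : 1 ≤ k) :
    incl (n - 1) n h1 h2 (t (n - 1) k) ≡
      t n k + gamma n (t n k) +
        ∑ j ∈ Ico 1 k, gamma n (t n j) * t n (k - j) ^ 2 ^ j [SMOD I n k] := by
  rw [SModEq.sub_mem, ← Ideal.Quotient.eq]
  let π := Ideal.Quotient.mk (I n k)
  rcases subsingleton_or_nontrivial (R n ⧸ I n k) with hs | hs
  · exact Subsingleton.elim _ _
  have h20 : (2 : R n ⧸ I n k) = 0 := Ideal.Quotient.eq_zero_iff_mem.mpr (two_mem_I n k)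
  have : CharP (R n ⧸ I n k) 2 := CharTwo.of_one_ne_zero_of_two_eq_zero one_ne_zero h20
  have hF1 := isAdditiveBelow_map_gamma (isAdditiveBelow_F n k)
  have hF2 := isAdditiveBelow_map_gamma hF1
  have hψ := (hasFormalSum_psi n).map π
  have hγψ := ((hasFormalSum_psi n).map (gamma n)).map π
  have hc := ((hasFormalSum_psi (n - 1)).map (incl (n - 1) n h1 h2)).map π
  rw [incl_map_gamma_F h1 h2, incl_psi h1 h2] at hc
  have hsubst : PowerSeries.map π
      (((psi n).toPowerSeries.map (gamma n)).subst (psi n).toPowerSeries) =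
      (((psi n).toPowerSeries.map (gamma n)).map π).subst ((psi n).toPowerSeries.map π) :=
    PowerSeries.map_subst (.of_constantCoeff_zero' (psi n).constantCoeff_eq) _
  rw [hsubst] at hc
  have hl := hc.coeff_two_pow hF2 le_rfl
  have hexp := PowerSeries.coeff_subst_eq_sum_two_pow (M := k) (d := Finsupp.single () (2 ^ k))
    (constantCoeff_map_psi π)
    (l := ((psi n).toPowerSeries.map (gamma n)).map π) (by
      rw [Finsupp.degree_single]
      exact Nat.pow_lt_pow_right one_lt_two k.lt_succ_self) (by
      intro e he hpow
      rw [Finsupp.degree_single] at he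
      rw [hγψ.coeff_eq_sum hF2 he]
      exact sum_eq_zero fun i _ => if_neg (hpow i))
  rw [PowerSeries.coeff] at hl
  rw [hl] at hexp
  have hterm : ∀ j ∈ range (k + 1),
      (((psi n).toPowerSeries.map (gamma n)).map π).coeff (2 ^ j) *
        MvPowerSeries.coeff (Finsupp.single () (2 ^ k)) (((psi n).toPowerSeries.map π) ^ 2 ^ j) =
      π (gamma n (t n j) * t n (k - j) ^ 2 ^ j) := by
    intro j hj
    have hj : j ≤ k := Nat.lt_succ_iff.mp (mem_range.mp hj)
    have h := PowerSeries.coeff_pow_two_pow ((psi n).toPowerSeries.map π) j (2 ^ (k - j))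
    rw [← pow_add, show j + (k - j) = k by omega, hψ.coeff_two_pow hF1 (by omega)] at h
    rw [hγψ.coeff_two_pow hF2 hj, map_mul π, map_pow π]
    exact congrArg _ h
  rw [sum_congr rfl hterm, ← map_sum] at hexp
  refine hexp.trans (congrArg π ?_)
  rw [sum_range_succ, range_eq_Ico, sum_eq_sum_Ico_succ_bot hk, Nat.sub_self, t_zero]
  simp
  ring

theorem unitQ_one_ell_succ (k : ℕ) : unitQ 1 1 (ell (k + 1)) = -unitQ 1 0 (ell (k + 1)) := by
  have h := gammaQ_pow_half 1 k
  simpa [unitQ, ell] using h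

/-- For `n = 1` the logarithm of `ℱ^γ` is `-l (-x)`, where `l` is the logarithm of `ℱ`. -/
theorem log_subst_neg {z : PowerSeries (NormQ 1)} (hz : z.constantCoeff = 0) :
    (logBP.map (unitQ 1 0 : BPQ →+* NormQ 1)).subst (-z) =
      -(logBP.map (unitQ 1 1 : BPQ →+* NormQ 1)).subst z := by
  have hz' : (-z).constantCoeff = 0 := by rw [map_neg, hz, neg_zero]
  refine MvPowerSeries.ext fun d => ?_
  have hd : d.degree < 2 ^ (d.degree + 1) :=
    Nat.lt_two_pow_self.trans (Nat.pow_lt_pow_right one_lt_two (Nat.lt_succ_self _))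
  rw [map_neg, (logBP_isTypical.map _).coeff_subst hz' hd,
    (logBP_isTypical.map _).coeff_subst hz hd, ← sum_neg_distrib]
  refine sum_congr rfl fun m _ => ?_
  rw [PowerSeries.coeff_map, PowerSeries.coeff_map, coeff_logBP]
  rcases m with _ | m
  · simp [show ell 0 = 1 from rfl]
  · have he : Even (2 ^ (m + 1)) := ⟨2 ^ m, by ring⟩
    have h := unitQ_one_ell_succ m
    rw [he.neg_pow]
    change unitQ 1 0 (ell (m + 1)) * _ = -(unitQ 1 1 (ell (m + 1)) * _)
    rw [h]
    ring

/-- For `n = 1` the series `-ψ (x)` is the inverse of `x` for `ℱ`. -/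
theorem F_subst_neg_psi : ((F 1).toPowerSeries.subst
    ![PowerSeries.X, -(psi 1).toPowerSeries] : PowerSeries (R 1)) = 0 := by
  have hψ : (-(psi 1).toPowerSeries).constantCoeff = 0 := by
    rw [map_neg, (psi 1).constantCoeff_eq, neg_zero]
  have hψQ : (-(psiQ 1 0 1).toPowerSeries).constantCoeff = 0 := by
    rw [map_neg, (psiQ 1 0 1).constantCoeff_eq, neg_zero]
  apply powerSeries_ext_of_map
  rw [map_subst_pair _ _ (by simp) hψ, map_neg, psi_map_subtype, F_map_subtype, PowerSeries.map_X,
    map_zero]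
  refine PowerSeries.eq_of_subst_eq (isTypicalLog_fglQ 1 0).coeff_one
    (constantCoeff_subst_pair _ (by simp) hψQ) (map_zero _) ?_
  rw [(isTypicalLog_fglQ 1 0).subst_pair _ _ (by simp) hψQ,
    log_subst_neg (psiQ 1 0 1).constantCoeff_eq, log_subst_psiQ, PowerSeries.X_subst,
    PowerSeries.subst_zero_of_constantCoeff_zero
      (isTypicalLog_fglQ 1 0).isTypical.constantCoeff_eq_zero, add_neg_cancel]

/-- Both sides are coefficients of `x ^ (2 ^ k)`: the left one of `ψ = -[-1]_ℱ`, the right one of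
`[2]_ℱ`.  Since `[-1]_ℱ (x)` agrees with `x` below this degree, the equation
`ℱ (x, [-1]_ℱ (x)) = 0` identifies them. -/
theorem mk_t_one_eq_mk_v {k : ℕ} (hk : 1 ≤ k) :
    Ideal.Quotient.mk (I 1 k) (t 1 k) = Ideal.Quotient.mk (I 1 k) (v 1 k) := by
  let π := Ideal.Quotient.mk (I 1 k)
  have h2 : (2 : R 1 ⧸ I 1 k) = 0 := Ideal.Quotient.eq_zero_iff_mem.mpr (two_mem_I 1 k)
  have hF := isAdditiveBelow_F 1 k
  have hψ0 : (-(psi 1).toPowerSeries).constantCoeff = 0 := by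
    rw [map_neg, (psi 1).constantCoeff_eq, neg_zero]
  set y := -(psi 1).toPowerSeries.map π with hy
  have hy0 : y.constantCoeff = 0 := by rw [hy, map_neg, constantCoeff_map_psi, neg_zero]
  have hFy : (((F 1).map π).toPowerSeries.subst ![PowerSeries.X, y] :
      PowerSeries (R 1 ⧸ I 1 k)) = 0 := by
    have h := congrArg (PowerSeries.map π) F_subst_neg_psi
    rwa [map_subst_pair _ _ (by simp) hψ0, map_neg, PowerSeries.map_X, map_zero] at h
  -- Below degree `2 ^ k` the inverse of `x` is `-x = x`.
  have hlow : ∀ d < 2 ^ k, y.coeff d = (PowerSeries.X : PowerSeries (R 1 ⧸ I 1 k)).coeff d := by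
    intro d hd
    have h := hF.coeff_subst_pair (p := PowerSeries.X) (q := y) (by simp) le_rfl
      (by rw [PowerSeries.order_eq_order]; exact MvPowerSeries.one_le_order hy0)
      (d := d) (by omega)
    rw [hFy, map_zero] at h
    linear_combination -h - h2 * (PowerSeries.X : PowerSeries (R 1 ⧸ I 1 k)).coeff d
  have h := coeff_subst_pair_sub_of_agree ((F 1).map π) (p := PowerSeries.X) (by simp) hy0
    (by simp) hlow
  have htwo : (((F 1).map π).toPowerSeries.subst ![PowerSeries.X, PowerSeries.X] :
      PowerSeries (R 1 ⧸ I 1 k)) = (F 1).twoSeries.map π := (map_twoSeries π (F 1)).symm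
  have hX : (PowerSeries.X : PowerSeries (R 1 ⧸ I 1 k)).coeff (2 ^ k) = 0 := by
    rw [PowerSeries.coeff_X, if_neg]
    exact (Nat.one_lt_two_pow (by omega)).ne'
  rw [hFy, htwo, hX, map_zero, zero_sub, sub_zero, hy, map_neg, neg_inj,
    ((hasFormalSum_psi 1).map π).coeff_two_pow (isAdditiveBelow_map_gamma hF) le_rfl,
    PowerSeries.coeff_map, ← mk_v] at h
  exact h.symm

theorem incl_t_one_smodEq {n k : ℕ} (hn : 1 ≤ n) (hk : 1 ≤ k) :
    incl 1 n le_rfl hn (t 1 k) ≡ v n k [SMOD I n k] := by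
  rw [SModEq.sub_mem, ← incl_v 1 n le_rfl hn, ← map_sub]
  exact incl_mem_I 1 n le_rfl hn k (Ideal.Quotient.eq.mp (mk_t_one_eq_mk_v hk))

end BPNorm

theorem mainTheorem1 :
    -- the defining expansions
    (∀ n : ℕ, 1 ≤ n →
      BPNorm.t n 0 = 1 ∧
      ((BPNorm.F n).map (BPNorm.gamma n)).HasFormalSum
        (fun k => PowerSeries.C (BPNorm.t n k) * PowerSeries.X ^ 2 ^ k)
        (BPNorm.psi n).toPowerSeries ∧
      (BPNorm.F n).HasFormalSum
        (fun k => PowerSeries.C (BPNorm.v n k) * PowerSeries.X ^ 2 ^ k)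
        (BPNorm.F n).twoSeries) ∧
    -- the recursion formula
    (∀ (n k : ℕ) (hn : 2 ≤ n), 1 ≤ k →
      BPNorm.incl (n - 1) n (by omega) (by omega) (BPNorm.t (n - 1) k) ≡
        BPNorm.t n k + BPNorm.gamma n (BPNorm.t n k) +
          ∑ j ∈ Finset.Ico 1 k, BPNorm.gamma n (BPNorm.t n j) * BPNorm.t n (k - j) ^ 2 ^ j
        [SMOD BPNorm.I n k]) ∧
    -- the relation between the generators at level one and the Araki generators
    (∀ (n k : ℕ) (hn : 1 ≤ n), 1 ≤ k →
      BPNorm.incl 1 n le_rfl hn (BPNorm.t 1 k) ≡ BPNorm.v n k [SMOD BPNorm.I n k]) :=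
  ⟨fun n _ => ⟨BPNorm.t_zero n, BPNorm.hasFormalSum_psi n, BPNorm.hasFormalSum_twoSeries n⟩,
    fun _ _ hn hk => BPNorm.incl_t_smodEq _ _ hk,
    fun _ _ hn hk => BPNorm.incl_t_one_smodEq hn hk⟩
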